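/- Let $\mathcal U$ be the category of Grothendieck toposes and geometric morphisms up to isomorphism. A *morphism of sites* between posets with Grothendieck topologies is a monotone map that preserves covering sieves and is covering-flat; it induces contravariantly a geometric morphism of sheaf toposes. For a poset $D$ with a subcanonical topology $K_D$ let $\mathrm{Id}_{K_D}(D)$ be the frame of $K_D$-ideals (lower sets $I$ with $d\in I$ whenever a $K_D$-covering sieve of $d$ consists of elements of $I$). A morphism of sites $v:D\to D'$ induces a frame homomorphism $\mathrm{Id}(v):\mathrm{Id}_{K_D}(D)\to \mathrm{Id}_{K_{D'}}(D')$ sending $I$ to the $K_{D'}$-ideal generated by $v(I)$, and $d\mapsto{\downarrow}d$ is a morphism of sites $D\to\mathrm{Id}_{K_D}(D)$ for the canonical topology on the frame. **The method (functional form).** Data: functors $I:\mathcal H\to\mathcal V$, $J:\mathcal K\to\mathcal V$, functions $f:\mathrm{Ob}\,\mathcal H\to\mathrm{Ob}\,\mathcal K$, $g:\mathrm{Ob}\,\mathcal K\to\mathrm{Ob}\,\mathcal H$, and arrows $\xi_C:I(C)\to J(f(C))$, $\chi_D:J(D)\to I(g(D))$. Hypotheses: $\chi_{f(C)}\circ\xi_C=I(\varepsilon_C^{-1})$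 for a chosen isomorphism $\varepsilon_C:g(f(C))\cong C$; $\xi_{g(D)}\circ\chi_D=J(\eta_D)$ for a chosen $\eta_D:D\to f(g(D))$; every $\xi_C$ and every $\eta_{f(C)}$ is an isomorphism. The category $\tilde R$ has the pairs $(C,f(C))$ as objects and as arrows the pairs $(u:C\to C',\,v:f(C)\to f(C'))$ with $\xi_{C'}\circ I(u)=J(v)\circ\xi_C$. The category $\tilde S$ has the pairs $(g(D),D)$ as objects and as arrows the triples $(z:g(D)\to g(D'),\,v:D\to D',\,w:f(g(D))\to f(g(D')))$ with $\chi_{D'}\circ J(v)=I(z)\circ\chi_D$ and $\xi_{g(D')}\circ I(z)=J(w)\circ\xi_{g(D)}$. The functor $\tilde Z:\tilde R\to\tilde S$ sends $(C,f(C))$ to $(g(f(C)),f(C))$ and $(u,v)$ to $(\varepsilon_{C'}^{-1}u\,\varepsilon_C,\;v,\;\eta_{f(C')}v\,\eta_{f(C)}^{-1})$; the functor $\tilde W:\tilde S\to\tilde R$ sends $(g(D),D)$ to $(g(D),f(g(D)))$ and $(z,v,w)$ to $(z,w)$. **Theorem, part 1.** Let $\mathcal H$ be a full subcategory of the category of frames,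 each frame $C$ carrying its canonical topology $J_C$, and let $\mathcal K$ be a category of posets $D$ equipped with subcanonical topologies $K_D$, whose arrows are the morphisms of sites. Let $f:\mathrm{Ob}\,\mathcal H\to\mathrm{Ob}\,\mathcal K$ be such that $f(C)$ is a basis of $C$ and $K_{f(C)}$ is the topology induced by $J_C$. Suppose $g(D):=\mathrm{Id}_{K_D}(D)$ belongs to $\mathcal H$ for all $D$ in $\mathcal K$. Assume that 1. for every $D$ in $\mathcal K$ the canonical map $D\to\mathrm{Id}_{K_D}(D)$, $d\mapsto{\downarrow}d$, factors through $f(\mathrm{Id}_{K_D}(D))\hookrightarrow\mathrm{Id}_{K_D}(D)$; 2. for every $C$ in $\mathcal H$ the canonical isomorphism $\mathrm{Id}_{K_{f(C)}}(f(C))\to C$, $I\mapsto\bigvee I$, maps $f(\mathrm{Id}_{K_{f(C)}}(f(C)))$ into $f(C)$. Then, for the functors $C\mapsto\mathbf{Sh}(C,J_C)$, $D\mapsto\mathbf{Sh}(D,K_D)$ to $\mathcal V=\mathcal U^{\mathrm{op}}$, the Comparison Lemma equivalences $\mathbf{Sh}(f(C),K_{f(C)})\simeq\mathbf{Sh}(C,J_C)$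 (as $\xi_C$) and $\mathbf{Sh}(\mathrm{Id}_{K_D}(D),J_{\mathrm{Id}_{K_D}(D)})\simeq\mathbf{Sh}(D,K_D)$ (as $\chi_D$) satisfy the hypotheses of the method, with $\varepsilon_C(I)=\bigvee I$ and $\eta_D(d)={\downarrow}d$; both are isomorphisms of $\mathcal U$. For every arrow $x:C\to C'$ of $\mathcal H$ there is at most one $y:f(C)\to f(C')$ with $\xi_{C'}\circ I(x)=J(y)\circ\xi_C$, and for every arrow $y:D\to D'$ of $\mathcal K$ at most one $x:g(D)\to g(D')$ with $\chi_{D'}\circ J(y)=I(x)\circ\chi_D$. The functor $\tilde Z$ is full and faithful and right adjoint to $\tilde W$. Moreover: - $\tilde R$ is the category of frames in $\mathcal H$ with the frame homomorphisms $C\to C'$ that map $f(C)$ into $f(C')$; - $\tilde S$ is the category of posets in $\mathcal K$ with the morphisms of sites $v:D\to D'$ such that $\mathrm{Id}(v)$ maps $f(\mathrm{Id}_{K_D}(D))$ into $f(\mathrm{Id}_{K_{D'}}(D'))$; - $\tilde Z$ sends a frame $C$ to $f(C)$ and a homomorphism to its restriction $f(C)\to f(C')$, and $\tilde W$ sends $D$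 to $\mathrm{Id}_{K_D}(D)$ and $v$ to $\mathrm{Id}(v)$. **Part 2 (localic Stone reflection).** For a Boolean algebra $B$ with its coherent topology let $\mathrm{Id}(B)$ be its frame of ideals, and for a frame $F$ let $F_c$ be the Boolean algebra of its complemented elements. The functors $B\mapsto\mathbf{Sh}(B,J^{coh}_B)$ and $F\mapsto\mathbf{Sh}(F,J_F)$ from $\mathbf{Bool}^{\mathrm{op}}$ and $\mathbf{Frm}^{\mathrm{op}}$ to $\mathcal U$, with $f(B)=\mathrm{Id}(B)$, $g(F)=F_c$, the equivalences $\xi_B:\mathbf{Sh}(B,J^{coh}_B)\simeq\mathbf{Sh}(\mathrm{Id}(B),J_{\mathrm{Id}(B)})$ and the geometric morphisms $\chi_F:\mathbf{Sh}(F,J_F)\to\mathbf{Sh}(F_c,J^{coh}_{F_c})$ induced by the inclusions, satisfy the hypotheses of the method. The resulting $\tilde Z$ is full and faithful and right adjoint to $\tilde W$; the projections $\tilde R\to\mathbf{Bool}^{\mathrm{op}}$ and $\tilde S\to\mathbf{Frm}^{\mathrm{op}}$ are equivalences, under which $\tilde Z$ and $\tilde W$ become $\mathrm{Id}^{\mathrm{op}}$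 and $(-)_c^{\mathrm{op}}$. Thus $\mathrm{Id}:\mathbf{Bool}\to\mathbf{Frm}$ is left adjoint to $(-)_c:\mathbf{Frm}\to\mathbf{Bool}$, with invertible unit $b\mapsto{\downarrow}b$ and counit $I\mapsto\bigvee I$. -/

import Mathlib

open CategoryTheory CategoryTheory.Limits Opposite
universe u

set_option linter.unusedVariables false

namespace FramePoset

section Sieves

variable {X : Type u} [PartialOrder X]

theorem yoneda_subsingleton {x : X} {y : Xᵒᵖ} (a b : (yoneda.obj x).obj y) : a = b :=
  Subsingleton.elim (α := (y.unop ⟶ x)) a b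

/-- In the canonical topology of a frame a sieve on `c` covers iff the join of its members is `c`. -/
theorem mem_canonical_frame {C : Type u} [Order.Frame C] {c : C} (S : Sieve c) :
    S ∈ Sheaf.canonicalTopology C c ↔ sSup {e : C | ∃ h : e ⟶ c, S h} = c := by
  constructor
  · intro hS
    have hle : sSup {e : C | ∃ h : e ⟶ c, S h} ≤ c := sSup_le (fun e ⟨h, _⟩ => leOfHom h)
    refine le_antisymm hle ?_
    have := Sheaf.isSheaf_yoneda_obj (sSup {e : C | ∃ h : e ⟶ c, S h}) S hS
    obtain ⟨t, -, -⟩ := this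
      (fun e h hh => homOfLE (le_sSup ⟨h, hh⟩)) (fun _ _ _ _ _ _ _ _ _ _ => yoneda_subsingleton _ _)
    exact leOfHom t
  · intro hS
    refine Sheaf.mem_finestTopology_of_forall_isSheafFor ?_
    rintro _ ⟨x, rfl⟩ e f x' _
    have hx : e ≤ x := by
      have : e = sSup {e' : C | ∃ h : e' ⟶ c, S h} ⊓ e := by
        rw [hS]; exact (inf_eq_right.2 (leOfHom f)).symm
      rw [this, sSup_inf_eq]
      refine iSup₂_le (fun a ⟨h, ha⟩ => ?_)
      have hm : (S.pullback f) (homOfLE (inf_le_right : a ⊓ e ≤ e)) := by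
        exact S.downward_closed ha (homOfLE (inf_le_left : a ⊓ e ≤ a))
      exact leOfHom (x' _ hm)
    exact ⟨homOfLE hx, fun _ _ _ => yoneda_subsingleton _ _, fun _ _ => yoneda_subsingleton _ _⟩

theorem le_of_covers (J : GrothendieckTopology X) [J.Subcanonical] {d x : X} {S : Sieve d}
    (hS : S ∈ J d) (hx : ∀ (e : X) (h : e ⟶ d), S h → e ≤ x) : d ≤ x := by
  obtain ⟨t, -, -⟩ := Sheaf.isSheaf_yoneda_obj x S (J.le_canonical d hS)
      (fun e h hh => homOfLE (hx e h hh)) (fun _ _ _ _ _ _ _ _ _ _ => yoneda_subsingleton _ _)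
  exact leOfHom t

theorem subcanonical_of_le (J : GrothendieckTopology X)
    (H : ∀ (d x : X) (S : Sieve d), S ∈ J d → (∀ (e : X) (h : e ⟶ d), S h → e ≤ x) → d ≤ x) :
    J.Subcanonical := by
  refine .of_isSheaf_yoneda_obj _ fun x d S hS t _ => ?_
  have hd : d ≤ x := H d x S hS (fun e h hh => leOfHom (t h hh))
  exact ⟨homOfLE hd, fun _ _ _ => yoneda_subsingleton _ _, fun _ _ => yoneda_subsingleton _ _⟩

end Sieves

/-- A poset equipped with a subcanonical Grothendieck topology. -/
structure PosetSite : Type (u + 1) where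
  carrier : Type u
  [order : PartialOrder carrier]
  top : GrothendieckTopology carrier
  [subcanonical : top.Subcanonical]

namespace PosetSite

instance : CoeSort PosetSite.{u} (Type u) := ⟨PosetSite.carrier⟩

attribute [instance] PosetSite.order PosetSite.subcanonical

/-- A morphism of sites between posets with Grothendieck topologies: a monotone map that preserves
covering sieves and is covering-flat. -/
@[ext]
structure Hom (X Y : PosetSite.{u}) where
  toFun : X → Y
  monotone : Monotone toFun
  coverPreserving : CoverPreserving X.top Y.top monotone.functor
  flat_top : ∀ y : Y, ∃ T ∈ Y.top y, ∀ (e : Y) (h : e ⟶ y), T h → ∃ x : X, e ≤ toFun x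
  flat_inf : ∀ (x₁ x₂ : X) (y : Y), y ≤ toFun x₁ → y ≤ toFun x₂ → ∃ T ∈ Y.top y,
    ∀ (e : Y) (h : e ⟶ y), T h → ∃ x : X, x ≤ x₁ ∧ x ≤ x₂ ∧ e ≤ toFun x

theorem Hom.cover {X Y : PosetSite.{u}} (φ : Hom X Y) {x : X} {S : Sieve x} (hS : S ∈ X.top x) :
    ∃ T ∈ Y.top (φ.toFun x), ∀ (e : Y) (h : e ⟶ φ.toFun x), T h →
      ∃ (x' : X) (h' : x' ⟶ x), S h' ∧ e ≤ φ.toFun x' := by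
  refine ⟨_, φ.coverPreserving.cover_preserve hS, ?_⟩
  rintro e h ⟨x', h', k, hh', -⟩
  exact ⟨x', h', hh', leOfHom k⟩

instance : Category PosetSite.{u} where
  Hom := Hom
  id X :=
    { toFun := id
      monotone := monotone_id
      coverPreserving := idCoverPreserving _
      flat_top := fun y => ⟨⊤, X.top.top_mem y, fun e _ _ => ⟨e, le_rfl⟩⟩
      flat_inf := fun x₁ x₂ y h₁ h₂ => ⟨⊤, X.top.top_mem y, fun e h _ =>
        ⟨e, (leOfHom h).trans h₁, (leOfHom h).trans h₂, le_rfl⟩⟩ }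
  comp {X Y Z} φ ψ :=
    { toFun := ψ.toFun ∘ φ.toFun
      monotone := ψ.monotone.comp φ.monotone
      coverPreserving := CoverPreserving.comp (hF := φ.coverPreserving) (hG := ψ.coverPreserving)
      flat_top := fun z => by
        obtain ⟨T, hT, hT'⟩ := ψ.flat_top z
        let R : Sieve z :=
          { arrows := fun e _ => ∃ x, e ≤ ψ.toFun (φ.toFun x)
            downward_closed := fun ⟨x, hx⟩ g => ⟨x, (leOfHom g).trans hx⟩ }
        refine ⟨R, Z.top.transitive hT R (fun e h hh => ?_), fun e h hh => hh⟩
        obtain ⟨y, hy⟩ := hT' e h hh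
        obtain ⟨V, hV, hV'⟩ := φ.flat_top y
        obtain ⟨W, hW, hW'⟩ := ψ.cover hV
        refine Z.top.superset_covering ?_ (Z.top.pullback_stable (homOfLE hy) hW)
        intro e' h' hh'
        obtain ⟨y', k, hk, hle⟩ := hW' _ _ hh'
        obtain ⟨x, hx⟩ := hV' _ _ hk
        exact ⟨x, hle.trans (ψ.monotone hx)⟩
      flat_inf := fun x₁ x₂ z h₁ h₂ => by
        obtain ⟨T, hT, hT'⟩ := ψ.flat_inf _ _ z h₁ h₂
        let R : Sieve z :=
          { arrows := fun e _ => ∃ x, x ≤ x₁ ∧ x ≤ x₂ ∧ e ≤ ψ.toFun (φ.toFun x)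
            downward_closed := fun ⟨x, hx₁, hx₂, hx⟩ g => ⟨x, hx₁, hx₂, (leOfHom g).trans hx⟩ }
        refine ⟨R, Z.top.transitive hT R (fun e h hh => ?_), fun e h hh => hh⟩
        obtain ⟨y, hy₁, hy₂, hy⟩ := hT' e h hh
        obtain ⟨V, hV, hV'⟩ := φ.flat_inf x₁ x₂ y hy₁ hy₂
        obtain ⟨W, hW, hW'⟩ := ψ.cover hV
        refine Z.top.superset_covering ?_ (Z.top.pullback_stable (homOfLE hy) hW)
        intro e' h' hh'
        obtain ⟨y', k, hk, hle⟩ := hW' _ _ hh'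
        obtain ⟨x, hx₁, hx₂, hx⟩ := hV' _ _ hk
        exact ⟨x, hx₁, hx₂, hle.trans (ψ.monotone hx)⟩ }

@[ext]
theorem hom_ext {X Y : PosetSite.{u}} {φ ψ : X ⟶ Y} (h : ∀ x, φ.toFun x = ψ.toFun x) : φ = ψ :=
  Hom.ext (funext h)

@[simp] theorem id_toFun (X : PosetSite.{u}) (x : X) : Hom.toFun (𝟙 X) x = x := rfl

@[simp] theorem comp_toFun {X Y Z : PosetSite.{u}} (φ : X ⟶ Y) (ψ : Y ⟶ Z) (x : X) :
    (φ ≫ ψ).toFun x = ψ.toFun (φ.toFun x) := rfl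

end PosetSite

/-- The `K`-ideals of a poset `X` with Grothendieck topology `K`: the lower sets `I` such that `d ∈ I`
as soon as some `K`-covering sieve of `d` consists of elements of `I`. -/
@[ext]
structure KIdeal (X : PosetSite.{u}) where
  carrier : Set X
  lower : ∀ ⦃d e : X⦄, e ≤ d → d ∈ carrier → e ∈ carrier
  closed : ∀ (d : X) (S : Sieve d), S ∈ X.top d →
    (∀ (e : X) (h : e ⟶ d), S h → e ∈ carrier) → d ∈ carrier

namespace KIdeal

variable {X : PosetSite.{u}}

instance : SetLike (KIdeal X) X where
  coe := KIdeal.carrier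
  coe_injective I I' h := by cases I; cases I'; congr

/-- `K`-ideals are ordered by inclusion. -/
instance : PartialOrder (KIdeal X) := PartialOrder.lift (fun I => (I : Set X)) SetLike.coe_injective

theorem le_iff {I I' : KIdeal X} : I ≤ I' ↔ ∀ d ∈ I, d ∈ I' := Iff.rfl

instance : InfSet (KIdeal X) where
  sInf s :=
    { carrier := {d | ∀ I ∈ s, d ∈ I}
      lower := fun d e hed hd I hI => I.lower hed (hd I hI)
      closed := fun d S hS h I hI => I.closed d S hS (fun e k hk => h e k hk I hI) }

instance : CompleteLattice (KIdeal X) :=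
  { completeLatticeOfInf (KIdeal X) (fun s =>
      ⟨fun I hI d hd => hd I hI, fun I hI d hd I' hI' => hI hI' hd⟩) with
    inf := fun I I' =>
      { carrier := {d | d ∈ I ∧ d ∈ I'}
        lower := fun d e hed hd => ⟨I.lower hed hd.1, I'.lower hed hd.2⟩
        closed := fun d S hS h => ⟨I.closed d S hS (fun e k hk => (h e k hk).1),
          I'.closed d S hS (fun e k hk => (h e k hk).2)⟩ }
    inf_le_left := fun I I' d hd => hd.1
    inf_le_right := fun I I' d hd => hd.2
    le_inf := fun I I' I'' h h' d hd => ⟨h hd, h' hd⟩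
    top :=
      { carrier := Set.univ
        lower := fun _ _ _ _ => trivial
        closed := fun _ _ _ _ => trivial }
    le_top := fun I d hd => trivial }

theorem mem_inf {I I' : KIdeal X} {d : X} : d ∈ I ⊓ I' ↔ d ∈ I ∧ d ∈ I' := Iff.rfl

theorem mem_top (d : X) : d ∈ (⊤ : KIdeal X) := trivial

instance : Order.Frame (KIdeal X) :=
  Order.Frame.ofMinimalAxioms
    { inf_sSup_le_iSup_inf := fun I s => by
        let T : KIdeal X := ⨆ I' ∈ s, I ⊓ I'
        let Q : KIdeal X :=
          { carrier := {d | ∀ e ≤ d, e ∈ I → e ∈ T}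
            lower := fun d e hed hd e' he' => hd e' (he'.trans hed)
            closed := fun d S hS h e hed heI => by
              refine T.closed e (S.pullback (homOfLE hed)) (X.top.pullback_stable _ hS) ?_
              intro e' k hk
              exact h e' _ hk e' le_rfl (I.lower (leOfHom k) heI) }
        have hQ : sSup s ≤ Q := sSup_le (fun I' hI' d hd e hed heI =>
          (le_iSup₂_of_le (f := fun I' (_ : I' ∈ s) => I ⊓ I') I' hI' le_rfl : I ⊓ I' ≤ T)
            ⟨heI, I'.lower hed hd⟩)
        intro d hd
        exact hQ hd.2 d le_rfl hd.1 }

/-- The principal ideal `↓d`, a `K`-ideal because `K` is subcanonical. -/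
def principal (d : X) : KIdeal X where
  carrier := Set.Iic d
  lower := fun _ _ h h' => le_trans h h'
  closed := fun _ _ hS h => le_of_covers X.top hS h

@[simp] theorem mem_principal {d e : X} : e ∈ principal d ↔ e ≤ d := Iff.rfl

theorem principal_le {d : X} {I : KIdeal X} : principal d ≤ I ↔ d ∈ I :=
  ⟨fun h => h (le_refl d), fun h _ he => I.lower he h⟩

/-- The `K`-ideal generated by a set. -/
def span (s : Set X) : KIdeal X := sInf {I | s ⊆ I}

theorem span_le {s : Set X} {I : KIdeal X} : span s ≤ I ↔ s ⊆ I :=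
  ⟨fun h d hd => h (fun _ hI => hI hd), fun h => sInf_le h⟩

theorem subset_span (s : Set X) : s ⊆ span s := span_le.1 le_rfl

variable {Y : PosetSite.{u}}

/-- The inverse image of a `K`-ideal under a morphism of sites. -/
def comap (φ : X ⟶ Y) (I : KIdeal Y) : KIdeal X where
  carrier := {x | φ.toFun x ∈ I}
  lower := fun _ _ h h' => I.lower (φ.monotone h) h'
  closed := fun d S hS h => by
    obtain ⟨T, hT, hT'⟩ := φ.cover hS
    refine I.closed _ T hT (fun e k hk => ?_)
    obtain ⟨x', h', hS', hle⟩ := hT' e k hk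
    exact I.lower hle (h x' h' hS')

/-- The frame homomorphism `Id_K(X) → Id_K(Y)` induced by a morphism of sites `X → Y`: it sends `I` to
the `K`-ideal generated by the image of `I`. -/
def map (φ : X ⟶ Y) : FrameHom (KIdeal X) (KIdeal Y) where
  toFun I := span (φ.toFun '' I)
  map_inf' I I' := by
    have gc : GaloisConnection (fun I : KIdeal X => span (φ.toFun '' I)) (comap φ) := fun I I' => by
      rw [span_le, Set.image_subset_iff]; rfl
    refine le_antisymm (le_inf (gc.monotone_l inf_le_left) (gc.monotone_l inf_le_right)) ?_
    let T : KIdeal Y := span (φ.toFun '' (I ⊓ I' : KIdeal X))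
    have key : span (φ.toFun '' I) ≤ span (φ.toFun '' I') ⇨ T := by
      rw [span_le]
      rintro _ ⟨x, hx, rfl⟩
      rw [SetLike.mem_coe, ← principal_le, le_himp_iff, inf_comm, ← le_himp_iff, span_le]
      rintro _ ⟨x', hx', rfl⟩
      rw [SetLike.mem_coe, ← principal_le, le_himp_iff]
      rintro y ⟨hy', hy⟩
      obtain ⟨V, hV, hV'⟩ := φ.flat_inf x x' y hy hy'
      refine T.closed y V hV (fun e k hk => ?_)
      obtain ⟨z, hz, hz', hez⟩ := hV' e k hk
      exact T.lower hez (subset_span _ ⟨z, ⟨I.lower hz hx, I'.lower hz' hx'⟩, rfl⟩)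
    exact le_himp_iff.1 key
  map_top' := by
    refine top_le_iff.1 (fun y _ => ?_)
    obtain ⟨V, hV, hV'⟩ := φ.flat_top y
    refine (span _).closed y V hV (fun e k hk => ?_)
    obtain ⟨x, hx⟩ := hV' e k hk
    exact (span _).lower hx (subset_span _ ⟨x, mem_top x, rfl⟩)
  map_sSup' s := by
    have gc : GaloisConnection (fun I : KIdeal X => span (φ.toFun '' I)) (comap φ) := fun I I' => by
      rw [span_le, Set.image_subset_iff]; rfl
    rw [sSup_image]
    exact gc.l_sSup

theorem map_le_iff (φ : X ⟶ Y) (I : KIdeal X) (I' : KIdeal Y) :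
    map φ I ≤ I' ↔ ∀ x ∈ I, φ.toFun x ∈ I' := by
  change span _ ≤ I' ↔ _
  rw [span_le, Set.image_subset_iff]; rfl

theorem map_principal (φ : X ⟶ Y) (x : X) : map φ (principal x) = principal (φ.toFun x) := by
  apply le_antisymm
  · rw [map_le_iff]; exact fun x' hx' => φ.monotone hx'
  · rw [principal_le]; exact subset_span _ ⟨x, le_refl x, rfl⟩

theorem eq_sSup (I : KIdeal X) : I = sSup (principal '' (I : Set X)) := by
  apply le_antisymm
  · intro d hd
    exact principal_le.1 (le_sSup ⟨d, hd, rfl⟩)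
  · apply sSup_le
    rintro _ ⟨d, hd, rfl⟩
    exact principal_le.2 hd

end KIdeal

/-- The functor sending a poset with subcanonical topology to its frame of `K`-ideals. -/
def idl : PosetSite.{u} ⥤ Frm.{u} where
  obj X := Frm.of (KIdeal X)
  map φ := Frm.ofHom (KIdeal.map φ)
  map_id X := by
    refine Frm.ext (fun I => ?_)
    refine eq_of_forall_ge_iff (fun I' => ?_)
    exact KIdeal.map_le_iff (𝟙 X) I I'
  map_comp {X Y Z} φ ψ := by
    refine Frm.ext (fun I => ?_)
    refine eq_of_forall_ge_iff (fun I' => ?_)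
    refine (KIdeal.map_le_iff (φ ≫ ψ) I I').trans ?_
    refine Iff.trans ?_ (KIdeal.map_le_iff ψ (KIdeal.map φ I) I').symm
    exact (KIdeal.map_le_iff φ I (KIdeal.comap ψ I')).symm

/-! ### Toposes -/

/-- A Grothendieck topos: a category equivalent to the category of sheaves of sets on a small
site. -/
structure Topos : Type (u + 2) where
  carrier : Type (u + 1)
  [cat : Category.{u} carrier]
  isTopos : ∃ (C : Type u) (_ : SmallCategory C) (J : GrothendieckTopology C),
    Nonempty (carrier ≌ Sheaf J (Type u))

attribute [instance] Topos.cat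

/-- A geometric morphism `E → F`: an adjunction whose left adjoint, the inverse image functor,
preserves finite limits. -/
structure GeomMorphism (E F : Topos.{u}) where
  inverseImage : F.carrier ⥤ E.carrier
  directImage : E.carrier ⥤ F.carrier
  adj : inverseImage ⊣ directImage
  lex : PreservesFiniteLimits inverseImage

namespace GeomMorphism

/-- The identity geometric morphism -/
def id (E : Topos.{u}) : GeomMorphism E E := ⟨𝟭 _, 𝟭 _, Adjunction.id, inferInstance⟩

/-- The composite of two geometric morphisms -/
def comp {E F G : Topos.{u}} (p : GeomMorphism E F) (q : GeomMorphism F G) : GeomMorphism E G where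
  inverseImage := q.inverseImage ⋙ p.inverseImage
  directImage := p.directImage ⋙ q.directImage
  adj := q.adj.comp p.adj
  lex := by
    have := p.lex
    have := q.lex
    exact comp_preservesFiniteLimits _ _

/-- Two geometric morphisms are identified when their inverse image functors are isomorphic. -/
instance setoid (E F : Topos.{u}) : Setoid (GeomMorphism E F) where
  r p q := Nonempty (p.inverseImage ≅ q.inverseImage)
  iseqv := ⟨fun _ => ⟨Iso.refl _⟩, fun ⟨e⟩ => ⟨e.symm⟩, fun ⟨e⟩ ⟨e'⟩ => ⟨e.trans e'⟩⟩

theorem equiv_of_directImage {E F : Topos.{u}} {p q : GeomMorphism E F}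
    (e : p.directImage ≅ q.directImage) : p ≈ q :=
  ⟨p.adj.leftAdjointUniq (q.adj.ofNatIsoRight e.symm)⟩

end GeomMorphism

/-- The category of Grothendieck toposes and geometric morphisms up to isomorphism. -/
instance : Category Topos.{u} where
  Hom E F := Quotient (GeomMorphism.setoid E F)
  id E := ⟦GeomMorphism.id E⟧
  comp p q := Quotient.map₂ GeomMorphism.comp
    (fun _ _ h _ _ h' => Nonempty.elim h fun e => Nonempty.elim h' fun e' =>
      ⟨Functor.isoWhiskerRight e' _ ≪≫ Functor.isoWhiskerLeft _ e⟩) p q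
  id_comp p := Quotient.inductionOn p (fun _ => Quotient.sound ⟨Functor.rightUnitor _⟩)
  comp_id p := Quotient.inductionOn p (fun _ => Quotient.sound ⟨Functor.leftUnitor _⟩)
  assoc p q r := Quotient.inductionOn₃ p q r
    (fun _ _ _ => Quotient.sound ⟨(Functor.associator _ _ _).symm⟩)

/-- The arrow of `Topos` represented by a geometric morphism. -/
def GeomMorphism.toHom {E F : Topos.{u}} (p : GeomMorphism E F) : E ⟶ F := ⟦p⟧

theorem GeomMorphism.isIso_toHom {E F : Topos.{u}} (p : GeomMorphism E F)
    [p.directImage.IsEquivalence] : IsIso p.toHom := by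
  let e := p.directImage.asEquivalence
  let q : GeomMorphism F E := ⟨p.directImage, e.inverse, e.toAdjunction, inferInstance⟩
  refine ⟨q.toHom, Quotient.sound ?_, Quotient.sound ?_⟩
  · exact GeomMorphism.equiv_of_directImage e.unitIso.symm
  · exact GeomMorphism.equiv_of_directImage e.counitIso

/-! ### Frames as sites, and bases -/

/-- The functor sending a frame to the same frame equipped with its canonical
topology. -/
def frm : Frm.{u} ⥤ PosetSite.{u} where
  obj C := { carrier := C, top := Sheaf.canonicalTopology C }
  map {C C'} h :=
    { toFun := h
      monotone := OrderHomClass.mono h.hom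
      coverPreserving := ⟨fun {c S} hS => by
        have hS' := (mem_canonical_frame (C := C) (c := c) S).1 hS
        refine (mem_canonical_frame (C := C') (c := h c) _).2
          (le_antisymm (sSup_le (fun e ⟨k, _⟩ => leOfHom k)) ?_)
        conv_lhs => rw [← hS']
        refine (map_sSup h.hom _).trans_le (sSup_le ?_)
        rintro _ ⟨a, ⟨k, hk⟩, rfl⟩
        refine le_sSup ⟨homOfLE (OrderHomClass.mono h.hom (leOfHom k)), a, k, 𝟙 _, hk, rfl⟩⟩
      flat_top := fun y => ⟨⊤, GrothendieckTopology.top_mem _ y, fun e _ _ =>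
        ⟨(⊤ : C), le_top.trans_eq (map_top h.hom).symm⟩⟩
      flat_inf := fun x₁ x₂ y h₁ h₂ => ⟨⊤, GrothendieckTopology.top_mem _ y, fun e k _ =>
        ⟨(x₁ ⊓ x₂ : C), inf_le_left, inf_le_right,
          ((leOfHom k).trans (le_inf h₁ h₂)).trans_eq (map_inf h.hom x₁ x₂).symm⟩⟩ }
  map_id _ := rfl
  map_comp _ _ := rfl

/-- `X` is, via the order embedding `i`, a basis of the frame `C` (every element of `C` is a join of
elements of the image), and the topology of `X` is the one induced by the canonical topology of `C`
(a sieve covers in `X` iff the sieve which it generates in `C` covers). -/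
structure IsBasis (X : PosetSite.{u}) (C : Frm.{u}) (i : X ↪o C) : Prop where
  basis : ∀ c : C, sSup {b : C | b ∈ Set.range i ∧ b ≤ c} = c
  induced : ∀ (d : X) (S : Sieve d),
    S ∈ X.top d ↔ S.functorPushforward i.monotone.functor ∈ Sheaf.canonicalTopology C (i.monotone.functor.obj d)

theorem IsBasis.mem_iff {X : PosetSite.{u}} {C : Frm.{u}} {i : X ↪o C} (hi : IsBasis X C i)
    {d : X} (S : Sieve d) :
    S ∈ X.top d ↔ sSup {b : C | ∃ (e : X) (h : e ⟶ d), S h ∧ i e = b} = i d := by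
  refine (hi.induced d S).trans ((mem_canonical_frame (C := C) (c := i d) _).trans ?_)
  have : sSup {e : C | ∃ h : e ⟶ i d, (S.functorPushforward i.monotone.functor) h} =
      sSup {b : C | ∃ (e : X) (h : e ⟶ d), S h ∧ i e = b} := by
    apply le_antisymm
    · refine sSup_le ?_
      rintro b ⟨h, e, k, l, hk, -⟩
      exact (leOfHom l).trans (le_sSup ⟨e, k, hk, rfl⟩)
    · refine sSup_le ?_
      rintro _ ⟨e, k, hk, rfl⟩
      exact le_sSup ⟨homOfLE (i.monotone (leOfHom k)), e, k, 𝟙 _, hk, rfl⟩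
  rw [this]

/-- The inclusion of a basis, as a morphism of sites. -/
def IsBasis.hom {X : PosetSite.{u}} {C : Frm.{u}} {i : X ↪o C} (hi : IsBasis X C i) :
    X ⟶ frm.obj C where
  toFun := i
  monotone := i.monotone
  coverPreserving := ⟨fun hS => (hi.induced _ _).1 hS⟩
  flat_top := fun (y : C) => by
    let T : Sieve y :=
      { arrows := fun e _ => ∃ x, e ≤ i x
        downward_closed := fun ⟨x, hx⟩ g => ⟨x, (leOfHom g).trans hx⟩ }
    refine ⟨T, ?_, fun e h hh => hh⟩
    refine (mem_canonical_frame T).2 (le_antisymm (sSup_le (fun e ⟨k, _⟩ => leOfHom k)) ?_)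
    conv_lhs => rw [← hi.basis y]
    refine sSup_le ?_
    rintro _ ⟨⟨x, rfl⟩, hb⟩
    exact le_sSup ⟨homOfLE hb, x, le_rfl⟩
  flat_inf := fun x₁ x₂ (y : C) h₁ h₂ => by
    let T : Sieve y :=
      { arrows := fun e _ => ∃ x, x ≤ x₁ ∧ x ≤ x₂ ∧ e ≤ i x
        downward_closed := fun ⟨x, hx₁, hx₂, hx⟩ g => ⟨x, hx₁, hx₂, (leOfHom g).trans hx⟩ }
    refine ⟨T, ?_, fun e h hh => hh⟩
    refine (mem_canonical_frame T).2 (le_antisymm (sSup_le (fun e ⟨k, _⟩ => leOfHom k)) ?_)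
    conv_lhs => rw [← hi.basis y]
    refine sSup_le ?_
    rintro _ ⟨⟨x, rfl⟩, hb⟩
    exact le_sSup ⟨homOfLE hb, x, i.le_iff_le.1 (hb.trans h₁), i.le_iff_le.1 (hb.trans h₂), le_rfl⟩

theorem IsBasis.isDenseSubsite {X : PosetSite.{u}} {C : Frm.{u}} {i : X ↪o C}
    (hi : IsBasis X C i) :
    hi.hom.monotone.functor.IsDenseSubsite X.top (frm.obj C).top where
  isCoverDense' := ⟨fun (c : C) => by
    refine (mem_canonical_frame (C := C) (c := c) _).2 (le_antisymm (sSup_le (fun e ⟨k, _⟩ => leOfHom k)) ?_)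
    conv_lhs => rw [← hi.basis c]
    refine sSup_le ?_
    rintro _ ⟨⟨x, rfl⟩, hb⟩
    exact le_sSup ⟨homOfLE hb, ⟨⟨x, 𝟙 _, homOfLE hb, rfl⟩⟩⟩⟩
  isLocallyFull' := by
    have : hi.hom.monotone.functor.Full :=
      ⟨fun f => ⟨homOfLE (i.le_iff_le.1 (leOfHom f)), rfl⟩⟩
    infer_instance
  isLocallyFaithful' := by
    have : hi.hom.monotone.functor.Faithful := ⟨fun _ => Subsingleton.elim _ _⟩
    infer_instance
  functorPushforward_mem_iff := (hi.induced _ _).symm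

/-- The canonical map `d ↦ ↓d` from `X` to its frame of `K`-ideals. -/
def principalEmbedding (X : PosetSite.{u}) : X ↪o (idl.obj X : Frm.{u}) where
  toFun := KIdeal.principal
  inj' d e h := le_antisymm (KIdeal.principal_le.1 h.le) (KIdeal.principal_le.1 h.ge)
  map_rel_iff' := KIdeal.principal_le

theorem isBasis_principal (X : PosetSite.{u}) :
    IsBasis X (idl.obj X) (principalEmbedding X) where
  basis I := by
    refine le_antisymm (sSup_le fun b hb => hb.2) (fun d hd => ?_)
    exact KIdeal.principal_le.1 (le_sSup ⟨⟨d, rfl⟩, KIdeal.principal_le.2 hd⟩)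
  induced d S := by
    refine Iff.trans ?_
      (mem_canonical_frame (C := KIdeal X) (c := KIdeal.principal d) _).symm
    constructor
    · intro hS
      refine le_antisymm (sSup_le (fun e ⟨k, _⟩ => leOfHom k)) (KIdeal.principal_le.2 ?_)
      refine KIdeal.closed _ d S hS (fun e k hk => KIdeal.principal_le.1 (le_sSup ?_))
      exact ⟨homOfLE ((principalEmbedding X).monotone (leOfHom k)), e, k, 𝟙 _, hk, rfl⟩
    · intro h
      let Q : KIdeal X :=
        { carrier := {e | ∃ k : e ⟶ d, S.pullback k ∈ X.top e}
          lower := fun e e' hle ⟨k, hk⟩ => ⟨homOfLE hle ≫ k, by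
            rw [Sieve.pullback_comp]; exact X.top.pullback_stable _ hk⟩
          closed := fun e T hT hh => by
            have hed : e ≤ d := le_of_covers X.top hT (fun e' k hk => (hh e' k hk).elim (fun l _ => leOfHom l))
            refine ⟨homOfLE hed, X.top.transitive hT _ (fun e' k hk => ?_)⟩
            obtain ⟨l, hl⟩ := hh e' k hk
            rw [← Sieve.pullback_comp]
            exact hl }
      have : KIdeal.principal d ≤ Q := by
        refine h.ge.trans (sSup_le ?_)
        rintro b ⟨l, e, k, l', hk, -⟩
        refine (leOfHom l').trans (KIdeal.principal_le.2 ⟨k, ?_⟩)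
        rw [S.pullback_eq_top_of_mem hk]
        exact X.top.top_mem _
      obtain ⟨k, hk⟩ := KIdeal.principal_le.1 this
      have hkk : k = 𝟙 d := Subsingleton.elim _ _
      rw [hkk, Sieve.pullback_id] at hk
      exact hk

/-- The canonical map `d ↦ ↓d` as a morphism of sites `(X, K) → (Id_K(X), canonical topology)`. -/
def principalHom (X : PosetSite.{u}) : X ⟶ frm.obj (idl.obj X) := (isBasis_principal X).hom

/-! ### The topos of sheaves -/

namespace PosetSite

theorem Hom.isContinuous {X Y : PosetSite.{u}} (φ : Hom X Y) :
    φ.monotone.functor.IsContinuous X.top Y.top := by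
  refine Functor.isContinuous_of_coverPreserving ⟨?_⟩ φ.coverPreserving
  intro ℱ Z T x hx Y₁ Y₂ W f₁ f₂ g₁ g₂ hg₁ hg₂ _
  obtain ⟨V, hV, hV'⟩ := φ.flat_inf Y₁ Y₂ W (leOfHom f₁) (leOfHom f₂)
  refine ((isSheaf_iff_isSheaf_of_type _ _).1 ℱ.property V hV).isSeparatedFor.ext ?_
  intro e k hk
  obtain ⟨z, hz₁, hz₂, hez⟩ := hV' e k hk
  have key := hx (homOfLE hz₁) (homOfLE hz₂) hg₁ hg₂ (Subsingleton.elim _ _)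
  have l : e ⟶ φ.monotone.functor.obj z := homOfLE hez
  have key' := congrArg (ℱ.obj.map l.op) key
  simp only [Functor.comp_map] at key'
  rw [← ConcreteCategory.comp_apply, ← ConcreteCategory.comp_apply, ← Functor.map_comp, ← Functor.map_comp] at key' ⊢
  exact key'

/-- The direct image functor `Sh(Y) ⥤ Sh(X)`: restriction along `φ`. -/
abbrev Hom.push {X Y : PosetSite.{u}} (φ : Hom X Y) :
    Sheaf Y.top (Type u) ⥤ Sheaf X.top (Type u) :=
  haveI := φ.isContinuous
  φ.monotone.functor.sheafPushforwardContinuous (Type u) X.top Y.top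

/-- The inverse image functor `Sh(X) ⥤ Sh(Y)`. -/
noncomputable abbrev Hom.pull {X Y : PosetSite.{u}} (φ : Hom X Y) :
    Sheaf X.top (Type u) ⥤ Sheaf Y.top (Type u) :=
  haveI := φ.isContinuous
  φ.monotone.functor.sheafPullback (Type u) X.top Y.top

/-- The inverse image functor is left adjoint to the direct image functor. -/
noncomputable def Hom.pullPush {X Y : PosetSite.{u}} (φ : Hom X Y) : φ.pull ⊣ φ.push :=
  haveI := φ.isContinuous
  φ.monotone.functor.sheafAdjunctionContinuous (Type u) X.top Y.top

end PosetSite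

theorem IsBasis.isEquivalence_push {X : PosetSite.{u}} {C : Frm.{u}} {i : X ↪o C}
    (hi : IsBasis X C i) : hi.hom.push.IsEquivalence := by
  have := hi.isDenseSubsite
  infer_instance

theorem lex_pull_frm {C C' : Frm.{u}} (h : C ⟶ C') :
    PreservesFiniteLimits (frm.map h).pull := by
  have : RepresentablyFlat (frm.map h).monotone.functor := ⟨fun c =>
    { nonempty := ⟨StructuredArrow.mk (Y := (⊤ : C))
        (homOfLE (le_top.trans_eq (map_top h.hom).symm : (show C' from c) ≤ h (⊤ : C)))⟩
      cone_objs := fun A B => by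
        have hA : (show C' from c) ≤ h A.right := leOfHom A.hom
        have hB : (show C' from c) ≤ h B.right := leOfHom B.hom
        let a : C := A.right
        let b : C := B.right
        exact ⟨StructuredArrow.mk (Y := (a ⊓ b : C))
          (homOfLE ((le_inf hA hB).trans_eq (map_inf h.hom a b).symm : (show C' from c) ≤ h (a ⊓ b))),
          StructuredArrow.homMk (homOfLE (inf_le_left : a ⊓ b ≤ a)) (Subsingleton.elim _ _),
          StructuredArrow.homMk (homOfLE (inf_le_right : a ⊓ b ≤ b)) (Subsingleton.elim _ _),
          trivial⟩
      cone_maps := fun A B f g => ⟨A, 𝟙 _, StructuredArrow.hom_ext _ _ (Subsingleton.elim _ _)⟩ }⟩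
  have := (frm.map h).isContinuous
  exact Functor.SmallCategories.instPreservesFiniteLimitsSheafSheafPullbackOfRepresentablyFlat
    (frm.map h).monotone.functor (Type u) _ _

theorem principal_comp {X Y : PosetSite.{u}} (φ : X ⟶ Y) :
    φ ≫ principalHom Y = principalHom X ≫ frm.map (idl.map φ) := by
  ext x
  exact (KIdeal.map_principal φ x).symm

theorem lex_of_iso {A B C D : Type*} [Category* A] [Category* B] [Category* C] [Category* D]
    {F : A ⥤ B} {G : B ⥤ D} {P : A ⥤ C} {Q : C ⥤ D} (e : F ⋙ G ≅ P ⋙ Q)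
    (hG : G.IsEquivalence) (hP : P.IsEquivalence) (hQ : PreservesFiniteLimits Q) :
    PreservesFiniteLimits F := by
  have : PreservesFiniteLimits (P ⋙ Q) := comp_preservesFiniteLimits _ _
  have : PreservesFiniteLimits (F ⋙ G) := preservesFiniteLimits_of_natIso e.symm
  have : PreservesFiniteLimits ((F ⋙ G) ⋙ G.asEquivalence.inverse) :=
    comp_preservesFiniteLimits _ _
  let e₂ : (F ⋙ G) ⋙ G.asEquivalence.inverse ≅ F :=
    Functor.associator _ _ _ ≪≫ Functor.isoWhiskerLeft F G.asEquivalence.unitIso.symm ≪≫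
      F.rightUnitor
  exact preservesFiniteLimits_of_natIso e₂

theorem lex_pull {X Y : PosetSite.{u}} (φ : X ⟶ Y) : PreservesFiniteLimits φ.pull := by
  have h₁ := (isBasis_principal X).isEquivalence_push
  have h₂ := (isBasis_principal Y).isEquivalence_push
  have h₃ := lex_pull_frm (idl.map φ)
  have h₄ : (principalHom X).pull.IsEquivalence :=
    @Adjunction.isEquivalence_left_of_isEquivalence_right _ _ _ _ _ _ (principalHom X).pullPush h₁
  have h₅ : (principalHom Y).pull.IsEquivalence :=
    @Adjunction.isEquivalence_left_of_isEquivalence_right _ _ _ _ _ _ (principalHom Y).pullPush h₂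
  have e : (principalHom Y).push ⋙ φ.push ≅ (frm.map (idl.map φ)).push ⋙ (principalHom X).push :=
    eqToIso (congrArg PosetSite.Hom.push (principal_comp φ))
  have e' : φ.pull ⋙ (principalHom Y).pull ≅ (principalHom X).pull ⋙ (frm.map (idl.map φ)).pull :=
    (φ.pullPush.comp (principalHom Y).pullPush).leftAdjointUniq
      (((principalHom X).pullPush.comp (frm.map (idl.map φ)).pullPush).ofNatIsoRight e.symm)
  exact lex_of_iso e' h₅ h₄ h₃

/-- The topos of sheaves of sets on a poset with a subcanonical topology. -/
def PosetSite.topos (X : PosetSite.{u}) : Topos.{u} :=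
  ⟨Sheaf X.top (Type u), X, inferInstance, X.top, ⟨CategoryTheory.Equivalence.refl⟩⟩

/-- The geometric morphism `Sh(Y) → Sh(X)` induced by a morphism of sites `X → Y`. -/
noncomputable def PosetSite.Hom.geom {X Y : PosetSite.{u}} (φ : X ⟶ Y) :
    GeomMorphism Y.topos X.topos :=
  ⟨φ.pull, φ.push, φ.pullPush, lex_pull φ⟩

/-- The functor sending a poset with a subcanonical topology to its topos of sheaves, and a morphism
of sites to the induced geometric morphism. -/
noncomputable def Sh : PosetSite.{u}ᵒᵖ ⥤ Topos.{u} where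
  obj X := X.unop.topos
  map φ := (PosetSite.Hom.geom φ.unop).toHom
  map_id X := Quotient.sound (GeomMorphism.equiv_of_directImage (Iso.refl _))
  map_comp φ ψ := Quotient.sound (GeomMorphism.equiv_of_directImage (Iso.refl _))


theorem IsBasis.isIso_Sh_map {X : PosetSite.{u}} {C : Frm.{u}} {i : X ↪o C}
    (hi : IsBasis X C i) : IsIso (Sh.map hi.hom.op) := by
  have : (PosetSite.Hom.geom hi.hom).directImage.IsEquivalence := hi.isEquivalence_push
  exact GeomMorphism.isIso_toHom (PosetSite.Hom.geom hi.hom)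

/-- The Comparison Lemma equivalence `Sh(C, J_C) ≃ Sh(X, K_X)` for a basis `X` of `C`. -/
noncomputable def IsBasis.comparison {X : PosetSite.{u}} {C : Frm.{u}} {i : X ↪o C}
    (hi : IsBasis X C i) : Sh.obj (op (frm.obj C)) ≅ Sh.obj (op X) :=
  haveI := hi.isIso_Sh_map
  asIso (Sh.map hi.hom.op)

/-! ### The general method for building reflections -/

section Method

universe v₁ v₂ v₃ u₁ u₂ u₃

variable {H : Type u₁} [Category.{v₁} H] {K : Type u₂} [Category.{v₂} K]
  {U : Type u₃} [Category.{v₃} U]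

/-- The data of the method for functional relations: the functions `f` and `g` on objects, whose
graphs `{(C, f C)}` and `{(g D, D)}` are the relations `R` and `S`, and the arrows `ξ` and `χ`.
The functions `Z : R → S` and `W : S → R` are `(C, f C) ↦ (g (f C), f C)` and
`(g D, D) ↦ (g D, f (g D))`. -/
structure MethodData (I : H ⥤ U) (J : K ⥤ U) where
  f : H → K
  g : K → H
  ξ : ∀ C : H, I.obj C ⟶ J.obj (f C)
  χ : ∀ D : K, J.obj D ⟶ I.obj (g D)

namespace MethodData

variable {I : H ⥤ U} {J : K ⥤ U} (M : MethodData I J)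

/-- The hypotheses of the method: the composites `χ ∘ ξ` are induced by chosen isomorphisms
`(ε C)⁻¹ : C → g (f C)` of `H`, the composites `ξ ∘ χ` are induced by chosen arrows
`η D : D → f (g D)` of `K`, all `ξ C` are isomorphisms, and all `η (f C)` are isomorphisms. -/
structure Conditions where
  ε : ∀ C : H, M.g (M.f C) ≅ C
  η : ∀ D : K, D ⟶ M.f (M.g D)
  ξ_comp_χ : ∀ C : H, M.ξ C ≫ M.χ (M.f C) = I.map (ε C).inv
  χ_comp_ξ : ∀ D : K, M.χ D ≫ M.ξ (M.g D) = J.map (η D)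
  isIso_ξ : ∀ C : H, IsIso (M.ξ C)
  isIso_η : ∀ C : H, IsIso (η (M.f C))

/-- The objects of the category `R̃`, i.e. the pairs `(C, f C)`, given by `C`. -/
structure RTilde (M : MethodData I J) where
  obj : H

/-- The objects of the category `S̃`, i.e. the pairs `(g D, D)`, given by `D`. -/
structure STilde (M : MethodData I J) where
  obj : K

variable {M}

/-- The arrows of `R̃`: the pairs `(u, v)` forming a commutative square with the `ξ`. -/
@[ext]
structure RHom (P P' : M.RTilde) where
  u : P.obj ⟶ P'.obj
  v : M.f P.obj ⟶ M.f P'.obj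
  comm : I.map u ≫ M.ξ P'.obj = M.ξ P.obj ≫ J.map v

/-- The arrows of `S̃`: the triples `(z, v, w)` forming commutative squares with the `χ` and `ξ`. -/
@[ext]
structure SHom (Q Q' : M.STilde) where
  z : M.g Q.obj ⟶ M.g Q'.obj
  v : Q.obj ⟶ Q'.obj
  w : M.f (M.g Q.obj) ⟶ M.f (M.g Q'.obj)
  comm_χ : J.map v ≫ M.χ Q'.obj = M.χ Q.obj ≫ I.map z
  comm_ξ : I.map z ≫ M.ξ (M.g Q'.obj) = M.ξ (M.g Q.obj) ≫ J.map w

instance : Category M.RTilde where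
  Hom := RHom
  id P := ⟨𝟙 _, 𝟙 _, by simp⟩
  comp a b := ⟨a.u ≫ b.u, a.v ≫ b.v, by
    rw [I.map_comp, J.map_comp, Category.assoc, b.comm, ← Category.assoc, a.comm,
      Category.assoc]⟩
  id_comp a := RHom.ext (Category.id_comp _) (Category.id_comp _)
  comp_id a := RHom.ext (Category.comp_id _) (Category.comp_id _)
  assoc a b c := RHom.ext (Category.assoc _ _ _) (Category.assoc _ _ _)

instance : Category M.STilde where
  Hom := SHom
  id P := ⟨𝟙 _, 𝟙 _, 𝟙 _, by simp, by simp⟩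
  comp a b := ⟨a.z ≫ b.z, a.v ≫ b.v, a.w ≫ b.w, by
    rw [I.map_comp, J.map_comp, Category.assoc, b.comm_χ, ← Category.assoc, a.comm_χ,
      Category.assoc], by
    rw [I.map_comp, J.map_comp, Category.assoc, b.comm_ξ, ← Category.assoc, a.comm_ξ,
      Category.assoc]⟩
  id_comp a := SHom.ext (Category.id_comp _) (Category.id_comp _) (Category.id_comp _)
  comp_id a := SHom.ext (Category.comp_id _) (Category.comp_id _) (Category.comp_id _)
  assoc a b c := SHom.ext (Category.assoc _ _ _) (Category.assoc _ _ _) (Category.assoc _ _ _)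

variable (M)

/-- The functor `(C, f C) ↦ C`, `(u, v) ↦ u`. -/
def forgetR : M.RTilde ⥤ H where
  obj P := P.obj
  map a := RHom.u a
  map_id _ := rfl
  map_comp _ _ := rfl

/-- The functor `(g D, D) ↦ D`, `(z, v, w) ↦ v`. -/
def forgetS : M.STilde ⥤ K where
  obj Q := Q.obj
  map b := SHom.v b
  map_id _ := rfl
  map_comp _ _ := rfl

/-- The functor `W̃ : (g D, D) ↦ (g D, f (g D))`, `(z, v, w) ↦ (z, w)`. -/
def WTilde : M.STilde ⥤ M.RTilde where
  obj Q := ⟨M.g Q.obj⟩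
  map b := RHom.mk b.z b.w b.comm_ξ
  map_id _ := rfl
  map_comp _ _ := rfl

variable {M}

theorem Conditions.isIso_χ (c : M.Conditions) (C : H) : IsIso (M.χ (M.f C)) := by
  have := c.isIso_ξ C
  have h : IsIso (M.ξ C ≫ M.χ (M.f C)) := by rw [c.ξ_comp_χ]; infer_instance
  exact IsIso.of_isIso_comp_left (M.ξ C) _

theorem Conditions.square (c : M.Conditions) {P P' : M.RTilde} (a : P ⟶ P') :
    J.map a.v ≫ M.χ (M.f P'.obj) =
      M.χ (M.f P.obj) ≫ I.map ((c.ε P.obj).hom ≫ a.u ≫ (c.ε P'.obj).inv) := by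
  have := c.isIso_ξ P.obj
  rw [← cancel_epi (M.ξ P.obj), ← Category.assoc, ← a.comm, Category.assoc, c.ξ_comp_χ,
    ← Category.assoc (M.ξ P.obj), c.ξ_comp_χ, ← I.map_comp, ← I.map_comp]
  simp

/-- The functor `Z̃ : (C, f C) ↦ (g (f C), f C)`, `(u, v) ↦ (z, v, w)`, where `z` is the transport of
`u` along the isomorphisms `ε` and `w` the transport of `v` along the isomorphisms `η`. -/
noncomputable def Conditions.ZTilde (c : M.Conditions) : M.RTilde ⥤ M.STilde where
  obj P := ⟨M.f P.obj⟩
  map {P P'} a :=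
    haveI := c.isIso_η P.obj
    SHom.mk ((c.ε P.obj).hom ≫ a.u ≫ (c.ε P'.obj).inv) a.v
      (inv (c.η (M.f P.obj)) ≫ a.v ≫ c.η (M.f P'.obj)) (c.square a) (by
        have := c.isIso_χ P.obj
        rw [← cancel_epi (M.χ (M.f P.obj)), ← Category.assoc, ← c.square a, Category.assoc,
          c.χ_comp_ξ, ← Category.assoc (M.χ (M.f P.obj)), c.χ_comp_ξ, ← J.map_comp,
          ← J.map_comp]
        simp)
  map_id P := by
    have := c.isIso_η P.obj
    refine SHom.ext ?_ rfl ?_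
    · change (c.ε P.obj).hom ≫ 𝟙 P.obj ≫ (c.ε P.obj).inv = 𝟙 _
      simp
    · change inv (c.η (M.f P.obj)) ≫ 𝟙 (M.f P.obj) ≫ c.η (M.f P.obj) = 𝟙 _
      simp
  map_comp {P P' P''} a b := by
    have := c.isIso_η P.obj
    have := c.isIso_η P'.obj
    refine SHom.ext ?_ rfl ?_
    · change (c.ε P.obj).hom ≫ (a.u ≫ b.u) ≫ (c.ε P''.obj).inv =
        ((c.ε P.obj).hom ≫ a.u ≫ (c.ε P'.obj).inv) ≫
          ((c.ε P'.obj).hom ≫ b.u ≫ (c.ε P''.obj).inv)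
      simp
    · change inv (c.η (M.f P.obj)) ≫ (a.v ≫ b.v) ≫ c.η (M.f P''.obj) =
        (inv (c.η (M.f P.obj)) ≫ a.v ≫ c.η (M.f P'.obj)) ≫
          (inv (c.η (M.f P'.obj)) ≫ b.v ≫ c.η (M.f P''.obj))
      simp

variable (M) in
/-- For every arrow `x` of `H` at most one `y` fits in a commutative square with the `ξ`. -/
def ConditionA : Prop :=
  ∀ (C C' : H) (x : C ⟶ C') (y y' : M.f C ⟶ M.f C'),
    I.map x ≫ M.ξ C' = M.ξ C ≫ J.map y → I.map x ≫ M.ξ C' = M.ξ C ≫ J.map y' → y = y'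

variable (M) in
/-- For every arrow `y` of `K` at most one `x` fits in a commutative square with the `χ`. -/
def ConditionB : Prop :=
  ∀ (D D' : K) (y : D ⟶ D') (x x' : M.g D ⟶ M.g D'),
    J.map y ≫ M.χ D' = M.χ D ≫ I.map x → J.map y ≫ M.χ D' = M.χ D ≫ I.map x' → x = x'

end MethodData

end Method

/-! ### Frames and bases -/

/-- A full subcategory `H` of frames and a full subcategory `K` of the category of posets with
subcanonical topologies and morphisms of sites, a function `f` assigning to every frame `C` of `H` an
object of `K` which is a basis of `C` with the induced topology, and the assumption that `H` contains
the frames of `K`-ideals of the objects of `K`. -/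
structure BasisData (H : ObjectProperty Frm.{u}) (K : ObjectProperty PosetSite.{u}) where
  f : H.FullSubcategory → K.FullSubcategory
  incl : ∀ C : H.FullSubcategory, (f C).obj ↪o C.obj
  isBasis : ∀ C : H.FullSubcategory, IsBasis (f C).obj C.obj (incl C)
  idl_mem : ∀ D : K.FullSubcategory, H (idl.obj D.obj)

namespace BasisData

variable {H : ObjectProperty Frm.{u}} {K : ObjectProperty PosetSite.{u}} (B : BasisData H K)

/-- The function `g(D) = Id_K(D)`. -/
abbrev g (D : K.FullSubcategory) : H.FullSubcategory := ⟨idl.obj D.obj, B.idl_mem D⟩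

/-- The element `b` of the basis `f(Id_K(D))`, as a `K`-ideal of `D`. -/
def ideal (D : K.FullSubcategory) (b : (B.f (B.g D)).obj) : KIdeal D.obj := B.incl (B.g D) b

/-- The join in `C` of a `K`-ideal of the basis `f(C)`. -/
def join (C : H.FullSubcategory) (I : KIdeal (B.f C).obj) : C.obj := sSup (B.incl C '' {x | x ∈ I})

/-- The data given by the Comparison Lemma equivalences. Sheaf toposes being contravariant in the
site, `I` and `J` take values in the opposite of the category of toposes: `ξ C` is the equivalence
`Sh(f(C)) → Sh(C)` inverse to the one induced by the inclusion of `f(C)` in `C`, and `χ D` is the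
geometric morphism `Sh(Id_K(D)) → Sh(D)` induced by `d ↦ ↓d`. -/
noncomputable def data :
    MethodData (H.ι ⋙ frm ⋙ Sh.rightOp) (K.ι ⋙ Sh.rightOp) where
  f := B.f
  g := B.g
  ξ C := (B.isBasis C).comparison.inv.op
  χ D := (Sh.map (principalHom D.obj).op).op

end BasisData

/-! ### Boolean algebras -/

section Bool

/-- The coherent topology on a distributive lattice: a sieve on `b` covers iff `b` is the join of
finitely many of its members. -/
def coherentTop (B : Type u) [DistribLattice B] [BoundedOrder B] : GrothendieckTopology B where
  sieves b := {S | ∃ t : Finset B, (∀ e ∈ t, ∃ h : e ⟶ b, S h) ∧ t.sup id = b}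
  top_mem' b := ⟨{b}, by simp [Finset.mem_singleton]; exact ⟨𝟙 b⟩, by simp⟩
  pullback_stable' := fun b b' S k ⟨t, ht, hb⟩ => by
    classical
    refine ⟨t.image (fun e => e ⊓ b'), ?_, ?_⟩
    · intro e he
      obtain ⟨e', he', rfl⟩ := Finset.mem_image.1 he
      obtain ⟨h, hh⟩ := ht e' he'
      exact ⟨homOfLE inf_le_right, S.downward_closed hh (homOfLE inf_le_left)⟩
    · rw [Finset.sup_image]
      change t.sup (fun e => e ⊓ b') = b'
      rw [← Finset.sup_inf_distrib_right]
      change t.sup id ⊓ b' = b'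
      rw [hb]
      exact inf_eq_right.2 (leOfHom k)
  transitive' := fun b S ⟨t, ht, hb⟩ R hR => by
    classical
    have : ∀ e ∈ t, ∃ s : Finset B, (∀ e' ∈ s, ∃ h : e' ⟶ b, R h) ∧ s.sup id = e := by
      intro e he
      obtain ⟨h, hh⟩ := ht e he
      obtain ⟨s, hs, hse⟩ := hR hh
      refine ⟨s, fun e' he' => ?_, hse⟩
      obtain ⟨l, hl⟩ := hs e' he'
      exact ⟨_, hl⟩
    choose! s hs hs' using this
    refine ⟨t.biUnion s, fun e' he' => ?_, ?_⟩
    · obtain ⟨e, he, he'⟩ := Finset.mem_biUnion.1 he'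
      exact hs e he e' he'
    · rw [Finset.sup_biUnion, ← hb]
      exact Finset.sup_congr rfl hs'

theorem mem_coherentTop {B : Type u} [DistribLattice B] [BoundedOrder B] {b : B} (S : Sieve b) :
    S ∈ coherentTop B b ↔ ∃ t : Finset B, (∀ e ∈ t, ∃ h : e ⟶ b, S h) ∧ t.sup id = b := Iff.rfl

instance (B : Type u) [DistribLattice B] [BoundedOrder B] : (coherentTop B).Subcanonical :=
  subcanonical_of_le _ (fun d x S ⟨t, ht, hd⟩ hx => by
    rw [← hd]
    refine Finset.sup_le (fun e he => ?_)
    obtain ⟨h, hh⟩ := ht e he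
    exact hx e h hh)

/-- The functor sending a Boolean algebra to the same poset with its coherent topology. -/
def boolSite : BoolAlg.{u} ⥤ PosetSite.{u} where
  obj B := { carrier := B, top := coherentTop B }
  map {B B'} h :=
    { toFun := h
      monotone := OrderHomClass.mono h.hom
      coverPreserving := ⟨fun {b S} hS => by
        classical
        obtain ⟨t, ht, hb⟩ := (mem_coherentTop (B := B) (b := b) S).1 hS
        refine (mem_coherentTop (B := B') (b := h b) _).2 ⟨t.image h, ?_, ?_⟩
        · intro e he
          obtain ⟨a, ha, rfl⟩ := Finset.mem_image.1 he
          obtain ⟨k, hk⟩ := ht a ha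
          exact ⟨homOfLE (OrderHomClass.mono h.hom (leOfHom k)), a, k, 𝟙 _, hk, rfl⟩
        · rw [Finset.sup_image, ← hb]
          exact (map_finset_sup h.hom t id).symm⟩
      flat_top := fun y => ⟨⊤, GrothendieckTopology.top_mem _ y, fun e _ _ =>
        ⟨(⊤ : B), (le_top (α := B')).trans_eq (map_top h.hom).symm⟩⟩
      flat_inf := fun x₁ x₂ y h₁ h₂ => ⟨⊤, GrothendieckTopology.top_mem _ y, fun e k _ =>
        ⟨(x₁ ⊓ x₂ : B), inf_le_left (α := B), inf_le_right (α := B),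
          ((leOfHom k).trans (le_inf (α := B') h₁ h₂)).trans_eq (map_inf h.hom x₁ x₂).symm⟩⟩ }
  map_id _ := rfl
  map_comp _ _ := rfl

noncomputable instance (F : Frm.{u}) : BooleanAlgebra (Complementeds F) :=
  DistribLattice.booleanAlgebraOfComplemented _

/-- The functor sending a frame to the Boolean algebra of its complemented elements. -/
noncomputable def complemented : Frm.{u} ⥤ BoolAlg.{u} where
  obj F := BoolAlg.of (Complementeds F)
  map {F F'} h := BoolAlg.ofHom
    { toFun := fun a => ⟨h a.1, by
        obtain ⟨b, hb⟩ := a.2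
        exact ⟨h b, hb.map h.hom⟩⟩
      map_sup' := fun a b => Subtype.ext (map_sup h.hom a.1 b.1)
      map_inf' := fun a b => Subtype.ext (map_inf h.hom a.1 b.1)
      map_top' := Subtype.ext (map_top h.hom)
      map_bot' := Subtype.ext (map_bot h.hom) }
  map_id _ := rfl
  map_comp _ _ := rfl

/-- The inclusion of the complemented elements of `F` in `F`, as a morphism of sites. -/
noncomputable def complementedHom (F : Frm.{u}) :
    boolSite.obj (complemented.obj F) ⟶ frm.obj F where
  toFun := fun a : Complementeds F => a.1
  monotone := fun _ _ h => h
  coverPreserving := ⟨fun {b S} hS => by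
    obtain ⟨t, ht, hb⟩ := (mem_coherentTop (B := Complementeds F) (b := b) S).1 hS
    let b' : Complementeds F := b
    refine (mem_canonical_frame (C := F) (c := b'.1) _).2
      (le_antisymm (sSup_le (fun e ⟨k, _⟩ => leOfHom k)) ?_)
    have hb' : t.sup (fun a : Complementeds F => a.1) = b'.1 := by
      change _ = (show Complementeds F from b).1
      rw [← hb]
      exact (Finset.apply_sup_eq_sup_comp (fun a : Complementeds F => a.1)
        (fun _ _ => rfl) rfl).symm
    refine hb'.ge.trans (Finset.sup_le (fun e he => ?_))
    obtain ⟨k, hk⟩ := ht e he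
    exact le_sSup ⟨homOfLE (leOfHom k : (show Complementeds F from e) ≤ b'), e, k, 𝟙 _, hk, rfl⟩⟩
  flat_top := fun y => ⟨⊤, GrothendieckTopology.top_mem _ y, fun e _ _ =>
    ⟨(⊤ : Complementeds F), le_top (α := F)⟩⟩
  flat_inf := fun x₁ x₂ y h₁ h₂ => ⟨⊤, GrothendieckTopology.top_mem _ y, fun e k _ =>
    ⟨@min (Complementeds F) _ x₁ x₂,
      inf_le_left (α := Complementeds F), inf_le_right (α := Complementeds F),
      (leOfHom k).trans (le_inf (α := F) h₁ h₂)⟩⟩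

/-- The data for Boolean algebras and frames: `f B` is the frame of ideals of `B`, `g F` the Boolean
algebra of complemented elements of `F`, `ξ B : Sh(B) → Sh(Id(B))` is the Comparison Lemma equivalence
and `χ F : Sh(F) → Sh(F_c)` the geometric morphism induced by the inclusion. -/
noncomputable def stoneData :
    MethodData (boolSite.{u}.op ⋙ Sh) (frm.{u}.op ⋙ Sh) where
  f B := op (idl.obj (boolSite.obj B.unop))
  g F := op (complemented.obj F.unop)
  ξ B := (isBasis_principal (boolSite.obj B.unop)).comparison.inv
  χ F := Sh.map (complementedHom F.unop).op

end Bool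

end FramePoset

open FramePoset

/-! The whole theorem rests on the faithfulness of `Sh`. If two morphisms of sites induce isomorphic
inverse images, then they induce isomorphic direct images. Evaluating a transformation of direct
images on representable sheaves, which exist by subcanonicity, recovers the inequalities between
values, so the two monotone maps are equal. Hence every commuting square of toposes made from sites
is a commuting square of monotone maps, with the Comparison Lemma equivalences moved to the side
where they are induced by basis inclusions (`comparison_square_iff`).

The reflection itself is formal. The unit of `W̃ ⊣ Z̃` is `(ε⁻¹, η, η)` and the counit is `(ε,
η⁻¹)`. Only the naturality of `η` with respect to arrows of `S̃` needs an argument, and it can be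
checked after applying the faithful functor `J`, where `J(η) = ξ ∘ χ` (`η_naturality`). The same
naturality gives fullness, since it forces the third component of an arrow between objects in the
image of `Z̃`.

For frames with bases, the ideals of a basis are the elements of the frame through joins
(`joinEquiv`), and a homomorphism out of a frame of ideals is determined by its values on principal
ideals (`idl_hom_ext`). So a `χ`-square says that the frame homomorphism is `Id(v)`, and a
`ξ`-square says that `v` is a restriction of `u`. A morphism of sites into a frame with values in a
basis corestricts to that basis (`factor`). This produces `η` from the first assumption, its inverse
on `f(C)` from the second, and the descriptions of `R̃` and `S̃`.

For Boolean algebras the key fact is that complemented ideals are principal (`exists_eq_principal`),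
which makes `b ↦ ↓b` an isomorphism onto the complemented ideals. All squares are then solved
uniquely by functoriality of ideals and of complemented elements, so both projections are
equivalences. -/

namespace FramePoset

/-! ### Faithfulness of the sheaf topos functor -/

/-- The representable sheaf of an element of a poset with a subcanonical topology. -/
def PosetSite.representable {X : PosetSite.{u}} (x : X) : Sheaf X.top (Type u) :=
  ⟨yoneda.obj x, (isSheaf_iff_isSheaf_of_type _ _).2
    (GrothendieckTopology.Subcanonical.isSheaf_of_isRepresentable (J := X.top) (yoneda.obj x))⟩

/-- A Yoneda argument: sections over `x` of the pushforward along `φ` of the sheaf represented by `φ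
x` are the arrows `φ x ⟶ φ x`, and the transformation carries the identity to an arrow `ψ x ⟶ φ x`.
-/
theorem PosetSite.Hom.le_of_push_hom {X Y : PosetSite.{u}} {φ ψ : X ⟶ Y}
    (e : φ.push ⟶ ψ.push) (x : X) : ψ.toFun x ≤ φ.toFun x := by
  let t : ψ.toFun x ⟶ φ.toFun x :=
    (e.app (PosetSite.representable (φ.toFun x))).hom.app (op x) (𝟙 (φ.toFun x))
  exact leOfHom t

/-- Equality in the quotient only gives an isomorphism of inverse images. Uniqueness of right
adjoints moves it to the direct images, and its two directions give the two inequalities. -/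
instance : Sh.{u}.Faithful where
  map_injective {X Y} φ ψ h := by
    obtain ⟨e⟩ := Quotient.exact h
    have e' : φ.unop.push ≅ ψ.unop.push :=
      Adjunction.rightAdjointUniq φ.unop.pullPush (ψ.unop.pullPush.ofNatIsoLeft e.symm)
    refine Quiver.Hom.unop_inj (PosetSite.hom_ext fun x => le_antisymm ?_ ?_)
    · exact PosetSite.Hom.le_of_push_hom e'.inv x
    · exact PosetSite.Hom.le_of_push_hom e'.hom x

instance : frm.{u}.Faithful where
  map_injective {C D} f g h := Frm.ext fun x => congrFun (congrArg PosetSite.Hom.toFun h) x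

instance : boolSite.{u}.Faithful where
  map_injective {C D} f g h := BoolAlg.ext fun x => congrFun (congrArg PosetSite.Hom.toFun h) x

/-! ### The reflection produced by the method -/

namespace MethodData

universe v₁ v₂ v₃ u₁ u₂ u₃

variable {H : Type u₁} [Category.{v₁} H] {K : Type u₂} [Category.{v₂} K]
  {U : Type u₃} [Category.{v₃} U] {I : H ⥤ U} {J : K ⥤ U} {M : MethodData I J}

theorem RTilde.hom_ext {P P' : M.RTilde} {a b : P ⟶ P'} (hu : a.u = b.u) (hv : a.v = b.v) :
    a = b := RHom.ext hu hv

theorem STilde.hom_ext {Q Q' : M.STilde} {a b : Q ⟶ Q'} (hz : a.z = b.z) (hv : a.v = b.v)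
    (hw : a.w = b.w) : a = b := SHom.ext hz hv hw

namespace Conditions

variable (c : M.Conditions)

/-- After applying `J`, both sides are the outer paths of the `χ`-square pasted with the `ξ`-square
of `a`. This is where the adjunction and fullness use faithfulness of `J`. -/
theorem η_naturality [J.Faithful] {Q Q' : M.STilde} (a : Q ⟶ Q') :
    a.v ≫ c.η Q'.obj = c.η Q.obj ≫ a.w := by
  apply J.map_injective
  rw [J.map_comp, J.map_comp, ← c.χ_comp_ξ, ← c.χ_comp_ξ, ← Category.assoc, a.comm_χ,
    Category.assoc, a.comm_ξ, Category.assoc]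

/-- The component `(ε⁻¹, η, η)` at `Q` of the unit of the adjunction between `W̃` and `Z̃`. -/
def unitApp (Q : M.STilde) : Q ⟶ c.ZTilde.obj (M.WTilde.obj Q) :=
  SHom.mk (c.ε (M.g Q.obj)).inv (c.η Q.obj) (c.η (M.f (M.g Q.obj)))
    (by
      change J.map (c.η Q.obj) ≫ M.χ (M.f (M.g Q.obj)) = _
      rw [← c.χ_comp_ξ, Category.assoc, c.ξ_comp_χ]; rfl)
    (by
      change I.map (c.ε (M.g Q.obj)).inv ≫ M.ξ (M.g (M.f (M.g Q.obj))) = _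
      rw [← c.ξ_comp_χ, Category.assoc, c.χ_comp_ξ]; rfl)

/-- The square required for `(ε, η⁻¹)` to be an arrow of `R̃`. Once `J(η)` is moved across and
expanded as `χ ≫ ξ`, the map `ξ ≫ χ = I(ε⁻¹)` cancels `I(ε)`. -/
theorem counit_comm (C : H) [IsIso (c.η (M.f C))] :
    I.map (c.ε C).hom ≫ M.ξ C = M.ξ (M.g (M.f C)) ≫ J.map (inv (c.η (M.f C))) := by
  rw [Functor.map_inv, IsIso.eq_comp_inv, ← c.χ_comp_ξ, Category.assoc, ← Category.assoc (M.ξ _),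
    c.ξ_comp_χ, ← Category.assoc, ← I.map_comp, Iso.hom_inv_id, I.map_id, Category.id_comp]

/-- The component `(ε, η⁻¹)` at `P` of the counit of the adjunction between `W̃` and `Z̃`. -/
noncomputable def counitApp (P : M.RTilde) : M.WTilde.obj (c.ZTilde.obj P) ⟶ P :=
  RHom.mk (c.ε P.obj).hom (@inv _ _ _ _ (c.η (M.f P.obj)) (c.isIso_η P.obj))
    (@counit_comm _ _ _ _ _ _ _ _ _ c P.obj (c.isIso_η P.obj))

theorem left_triangle_app (Q : M.STilde) :
    M.WTilde.map (c.unitApp Q) ≫ c.counitApp (M.WTilde.obj Q) = 𝟙 (M.WTilde.obj Q) :=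
  have := c.isIso_η (M.g Q.obj)
  RTilde.hom_ext (Iso.inv_hom_id (c.ε (M.g Q.obj))) (IsIso.hom_inv_id (c.η (M.f (M.g Q.obj))))

theorem right_triangle_app (P : M.RTilde) :
    c.unitApp (c.ZTilde.obj P) ≫ c.ZTilde.map (c.counitApp P) = 𝟙 (c.ZTilde.obj P) := by
  have := c.isIso_η P.obj
  have := c.isIso_η (M.g (M.f P.obj))
  refine STilde.hom_ext ?_ (IsIso.hom_inv_id (c.η (M.f P.obj))) ?_
  · change (c.ε (M.g (M.f P.obj))).inv ≫ ((c.ε _).hom ≫ (c.ε _).hom ≫ (c.ε _).inv) = 𝟙 _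
    simp
  · change c.η (M.f (M.g (M.f P.obj))) ≫ (inv (c.η _) ≫ inv (c.η _) ≫ c.η _) = 𝟙 _
    simp

/-- The reflection of the method. -/
noncomputable def adjunction [J.Faithful] : M.WTilde ⊣ c.ZTilde :=
  Adjunction.mkOfUnitCounit
    { unit :=
        { app := c.unitApp
          naturality := fun Q Q' a => STilde.hom_ext
            (by change a.z ≫ (c.ε _).inv = (c.ε _).inv ≫ (c.ε _).hom ≫ a.z ≫ (c.ε _).inv; simp)
            (c.η_naturality a)
            (by
              have := c.isIso_η (M.g Q.obj)
              change a.w ≫ c.η _ = c.η _ ≫ inv (c.η _) ≫ a.w ≫ c.η _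
              simp) }
      counit :=
        { app := c.counitApp
          naturality := fun P P' a => by
            have h := c.isIso_η P.obj
            have h' := c.isIso_η P'.obj
            refine RTilde.hom_ext ?_ ?_
            · change ((c.ε _).hom ≫ a.u ≫ (c.ε _).inv) ≫ (c.ε _).hom = (c.ε _).hom ≫ a.u
              simp
            · change (inv (c.η _) ≫ a.v ≫ c.η _) ≫ inv (c.η _) = inv (c.η _) ≫ a.v
              simp }
      left_triangle := by
        ext Q
        -- The triangle identity for whiskered transformations contains an associator whose
        -- components are identities; `Category.id_comp` removes it.
        exact (congrArg (_ ≫ ·) (Category.id_comp _)).trans (c.left_triangle_app Q)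
      right_triangle := by
        ext P
        exact (congrArg (_ ≫ ·) (Category.id_comp _)).trans (c.right_triangle_app P) }

theorem ZTilde_faithful : c.ZTilde.Faithful where
  map_injective {P P'} a b h := by
    refine RTilde.hom_ext ?_ (congrArg SHom.v h)
    have := congrArg SHom.z h
    change (c.ε _).hom ≫ a.u ≫ (c.ε _).inv = (c.ε _).hom ≫ b.u ≫ (c.ε _).inv at this
    simpa using this

/-- Since `χ` is invertible at objects `f C`, a `χ`-square there can be turned back into a
`ξ`-square after conjugating by `ε`. This is the converse of `Conditions.square`. -/
theorem comm_of_comm_χ {C C' : H} (z : M.g (M.f C) ⟶ M.g (M.f C')) (v : M.f C ⟶ M.f C')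
    (h : J.map v ≫ M.χ (M.f C') = M.χ (M.f C) ≫ I.map z) :
    I.map ((c.ε C).inv ≫ z ≫ (c.ε C').hom) ≫ M.ξ C' = M.ξ C ≫ J.map v := by
  have := c.isIso_χ C'
  rw [← cancel_mono (M.χ (M.f C')), Category.assoc, Category.assoc, c.ξ_comp_χ, h,
    ← Category.assoc (M.ξ _), c.ξ_comp_χ, ← I.map_comp, ← I.map_comp]
  simp

/-- The preimage has first component `z` conjugated by `ε`. The component `w` then agrees
automatically, because naturality of `η` determines it from `v` when `η` is invertible at the
source. -/
theorem ZTilde_full [J.Faithful] : c.ZTilde.Full where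
  map_surjective {P P'} b := by
    have := c.isIso_η P.obj
    refine ⟨RHom.mk ((c.ε P.obj).inv ≫ b.z ≫ (c.ε P'.obj).hom) b.v
      (c.comm_of_comm_χ b.z b.v b.comm_χ), STilde.hom_ext ?_ rfl ?_⟩
    · have (z : M.g (M.f P.obj) ⟶ M.g (M.f P'.obj)) : (c.ε P.obj).hom ≫
        ((c.ε P.obj).inv ≫ z ≫ (c.ε P'.obj).hom) ≫ (c.ε P'.obj).inv = z := by simp
      exact this b.z
    · exact (IsIso.inv_comp_eq (c.η (M.f P.obj))).2 (c.η_naturality b)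

end Conditions

end MethodData

/-! ### Frames of ideals -/

/-- The identity exhibits a frame as a basis of itself. -/
theorem isBasis_refl (C : Frm.{u}) : IsBasis (frm.obj C) C (OrderIso.refl C).toOrderEmbedding where
  basis c := le_antisymm (sSup_le fun b hb => hb.2) (le_sSup ⟨⟨c, rfl⟩, le_rfl⟩)
  induced d S := by
    have : S.functorPushforward (OrderIso.refl C).toOrderEmbedding.monotone.functor = S := by
      ext e k
      constructor
      · rintro ⟨e', h, l, hh, -⟩
        exact S.downward_closed hh l
      · intro hk
        exact ⟨e, k, 𝟙 _, hk, rfl⟩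
    exact (congrArg (· ∈ Sheaf.canonicalTopology C d) this).to_iff.symm

/-! ### Ideals of a basis, corestriction to a basis, and comparison squares. -/

namespace IsBasis

variable {X Y : PosetSite.{u}} {C D : Frm.{u}} {i : X ↪o C} {j : Y ↪o D}

/-- The bijection from the frame of ideals of a basis to the frame, sending an ideal to its join. -/
def joinEquiv (hi : IsBasis X C i) : KIdeal X ≃ C where
  toFun I := sSup (i '' {x | x ∈ I})
  invFun c :=
    { carrier := {x | i x ≤ c}
      lower := fun d e h hd => (i.monotone h).trans hd
      closed := fun d S hS h => by
        rw [hi.mem_iff] at hS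
        change i d ≤ c
        rw [← hS]
        refine sSup_le ?_
        rintro _ ⟨e, k, hk, rfl⟩
        exact h e k hk }
  left_inv I := by
    refine SetLike.ext fun d => ⟨fun (hd : i d ≤ sSup (i '' {x | x ∈ I})) => ?_,
      fun hd => le_sSup ⟨d, hd, rfl⟩⟩
    -- The members of `I` below `d` will cover `d`; closedness of `I` then gives `d ∈ I`.
    let S : Sieve d :=
      { arrows := fun e _ => e ∈ I
        downward_closed := fun h g => I.lower (leOfHom g) h }
    refine I.closed d S ?_ (fun e k hk => hk)
    rw [hi.mem_iff]
    refine le_antisymm (sSup_le ?_) ?_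
    · rintro _ ⟨e, k, hk, rfl⟩
      exact i.monotone (leOfHom k)
    -- By frame distributivity `i d` is the join of the meets `i d ⊓ i x` with `x ∈ I`. Such a meet
    -- need not lie in the basis, but it is a join of basis elements, and these lie in `I` because
    -- they are below `x`.
    · conv_lhs => rw [← inf_eq_left.2 hd, inf_sSup_eq]
      refine iSup₂_le ?_
      rintro _ ⟨x, hx, rfl⟩
      rw [← hi.basis (i d ⊓ i x)]
      refine sSup_le ?_
      rintro _ ⟨⟨e, rfl⟩, he⟩
      exact le_sSup ⟨e, homOfLE (i.le_iff_le.1 (he.trans inf_le_left)),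
        I.lower (i.le_iff_le.1 (he.trans inf_le_right)) hx, rfl⟩
  right_inv c := by
    refine le_antisymm (sSup_le ?_) ?_
    · rintro _ ⟨x, hx, rfl⟩
      exact hx
    · conv_lhs => rw [← hi.basis c]
      refine sSup_le ?_
      rintro _ ⟨⟨x, rfl⟩, hx⟩
      exact le_sSup ⟨x, hx, rfl⟩

/-- The isomorphism from the frame of ideals of a basis to the frame, sending an ideal to its join. -/
def joinIso (hi : IsBasis X C i) : KIdeal X ≃o C :=
  hi.joinEquiv.toOrderIso (fun _ _ h => sSup_le_sSup (Set.image_mono h))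
    (fun _ _ h _ hd => le_trans hd h)

theorem joinIso_principal (hi : IsBasis X C i) (x : X) :
    hi.joinIso (KIdeal.principal x) = i x :=
  le_antisymm (sSup_le (by rintro _ ⟨y, hy, rfl⟩; exact i.monotone hy))
    (le_sSup ⟨x, le_refl x, rfl⟩)

/-- The join of ideals, as an isomorphism in the category of frames. -/
def idlIso (hi : IsBasis X C i) : idl.obj X ≅ C := Frm.Iso.mk hi.joinIso

theorem idlIso_hom_principal (hi : IsBasis X C i) (x : X) :
    hi.idlIso.hom (KIdeal.principal x) = i x := hi.joinIso_principal x

theorem principalHom_comp_idlIso (hi : IsBasis X C i) :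
    principalHom X ≫ frm.map hi.idlIso.hom = hi.hom :=
  PosetSite.hom_ext hi.idlIso_hom_principal

theorem hom_comp_idlIso_inv (hi : IsBasis X C i) :
    hi.hom ≫ frm.map hi.idlIso.inv = principalHom X := by
  rw [← hi.principalHom_comp_idlIso, Category.assoc, ← frm.map_comp, Iso.hom_inv_id,
    frm.map_id, Category.comp_id]

/-- Each member of `T` is a join of basis elements, which belong to `T` as well, so the basis
elements of `T` already have join `i x`. This transfers covers and flatness conditions from the
frame to the basis. -/
theorem mem_of_cover (hi : IsBasis X C i) {x : X} {T : Sieve (i x)}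
    (hT : T ∈ Sheaf.canonicalTopology C (i x)) (S : Sieve x)
    (h : ∀ (e : X) (k : e ⟶ x) (l : i e ⟶ i x), T l → S k) : S ∈ X.top x := by
  have hT' := (mem_canonical_frame T).1 hT
  rw [hi.mem_iff]
  refine le_antisymm (sSup_le ?_) ?_
  · rintro _ ⟨e, k, hk, rfl⟩
    exact i.monotone (leOfHom k)
  · conv_lhs => rw [← hT']
    refine sSup_le ?_
    rintro a ⟨k, hk⟩
    rw [← hi.basis a]
    refine sSup_le ?_
    rintro _ ⟨⟨e, rfl⟩, he⟩
    exact le_sSup ⟨e, homOfLE (i.le_iff_le.1 (he.trans (leOfHom k))),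
      h e _ (homOfLE he ≫ k) (T.downward_closed hk _), rfl⟩

/-- A morphism of sites to a frame whose values lie in a basis, as a morphism to the basis. -/
noncomputable def factor (hi : IsBasis X C i) (φ : Y ⟶ frm.obj C)
    (h : ∀ y, ∃ x, i x = φ.toFun y) : Y ⟶ X :=
  haveI le_iff : ∀ x y, x ≤ (h y).choose ↔ (i x : C) ≤ φ.toFun y := fun x y => by
    rw [← i.le_iff_le, (h y).choose_spec]
  haveI mono : Monotone fun y => (h y).choose := fun a b hab =>
    (le_iff _ _).2 ((h a).choose_spec.trans_le (φ.monotone hab))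
  { toFun := fun y => (h y).choose
    monotone := mono
    coverPreserving := ⟨fun {d S} hS => by
      have hφ := φ.coverPreserving.cover_preserve hS
      have hd : (φ.toFun d : C) = i (h d).choose := (h d).choose_spec.symm
      -- The base of a sieve is part of its type. Hiding the pushforward sieve under an existential
      -- lets `φ d` be replaced by the equal element `i (h d).choose`.
      have hT : ∃ T ∈ Sheaf.canonicalTopology C (φ.toFun d : C), ∀ (e : C) (k : e ⟶ φ.toFun d),
          T.arrows k → ∃ (y : Y) (_ : ∃ l : y ⟶ d, S l), e ≤ φ.toFun y :=
        ⟨_, hφ, fun e k ⟨y, l, m, hl, _⟩ => ⟨y, ⟨l, hl⟩, leOfHom m⟩⟩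
      rw [hd] at hT
      obtain ⟨T, hT, hT'⟩ := hT
      refine hi.mem_of_cover hT _ (fun e k l hl => ?_)
      obtain ⟨y, ⟨m, hm⟩, hy⟩ := hT' _ l hl
      exact ⟨y, m, homOfLE ((le_iff _ _).2 hy), hm, Subsingleton.elim _ _⟩⟩
    flat_top := fun x => by
      obtain ⟨T, hT, hT'⟩ := φ.flat_top (i x : C)
      refine ⟨{ arrows := fun e _ => ∃ y, e ≤ (h y).choose
                downward_closed := fun ⟨y, hy⟩ g => ⟨y, (leOfHom g).trans hy⟩ },
        hi.mem_of_cover hT _ (fun e k l hl => ?_), fun e k hk => hk⟩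
      obtain ⟨y, hy⟩ := hT' _ l hl
      exact ⟨y, (le_iff _ _).2 hy⟩
    flat_inf := fun y₁ y₂ x h₁ h₂ => by
      obtain ⟨T, hT, hT'⟩ := φ.flat_inf y₁ y₂ (i x : C) ((le_iff _ _).1 h₁) ((le_iff _ _).1 h₂)
      refine ⟨{ arrows := fun e _ => ∃ y, y ≤ y₁ ∧ y ≤ y₂ ∧ e ≤ (h y).choose
                downward_closed := fun ⟨y, hy₁, hy₂, hy⟩ g =>
                  ⟨y, hy₁, hy₂, (leOfHom g).trans hy⟩ },
        hi.mem_of_cover hT _ (fun e k l hl => ?_), fun e k hk => hk⟩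
      obtain ⟨y, hy₁, hy₂, hy⟩ := hT' _ l hl
      exact ⟨y, hy₁, hy₂, (le_iff _ _).2 hy⟩ }

theorem factor_apply (hi : IsBasis X C i) (φ : Y ⟶ frm.obj C)
    (h : ∀ y, ∃ x, i x = φ.toFun y) (y : Y) : i ((hi.factor φ h).toFun y) = φ.toFun y :=
  (h y).choose_spec

theorem factor_comp (hi : IsBasis X C i) (φ : Y ⟶ frm.obj C)
    (h : ∀ y, ∃ x, i x = φ.toFun y) : hi.factor φ h ≫ hi.hom = φ :=
  PosetSite.hom_ext (hi.factor_apply φ h)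

theorem mono_hom (hi : IsBasis X C i) : Mono hi.hom :=
  ⟨fun f g h => PosetSite.hom_ext fun x =>
    i.injective (congrFun (congrArg PosetSite.Hom.toFun h) x)⟩

/-- The Comparison Lemma equivalences are compatible with a homomorphism of frames and a morphism
between bases iff the two agree on the bases. -/
theorem comparison_square_iff (hi : IsBasis X C i) (hj : IsBasis Y D j) (u : C ⟶ D) (v : X ⟶ Y) :
    Sh.map v.op ≫ hi.comparison.inv = hj.comparison.inv ≫ Sh.map (frm.map u).op ↔
      hi.hom ≫ frm.map u = v ≫ hj.hom := by
  rw [Iso.eq_inv_comp, ← Category.assoc, Iso.comp_inv_eq]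
  change Sh.map hj.hom.op ≫ Sh.map v.op = Sh.map (frm.map u).op ≫ Sh.map hi.hom.op ↔ _
  rw [← Sh.map_comp, ← Sh.map_comp, ← op_comp, ← op_comp, Sh.map_injective.eq_iff,
    Quiver.Hom.op_inj.eq_iff, eq_comm]

end IsBasis

/-! ### The universal property of the frame of ideals -/

theorem frm_map_sSup_image {A B : Frm.{u}} (f : A ⟶ B) {ι : Type*} (p : ι → A) (s : Set ι) :
    f (sSup (p '' s)) = sSup ((fun x => f (p x)) '' s) :=
  (map_sSup f.hom _).trans (congrArg sSup (Set.image_image f.hom p s))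

/-- Every ideal is the join of the principal ideals of its members, and frame homomorphisms preserve
joins. -/
theorem idl_hom_ext {X : PosetSite.{u}} {C : Frm.{u}} {f g : idl.obj X ⟶ C}
    (h : ∀ x : X, f (KIdeal.principal x) = g (KIdeal.principal x)) : f = g :=
  Frm.ext fun (I : KIdeal X) => by
    rw [I.eq_sSup]
    exact (frm_map_sSup_image f _ _).trans ((congrArg sSup (Set.image_congr fun x _ => h x)).trans
      (frm_map_sSup_image g _ _).symm)

theorem idl_map_principal {X Y : PosetSite.{u}} (φ : X ⟶ Y) (x : X) :
    (idl.map φ) (KIdeal.principal x) = KIdeal.principal (φ.toFun x) := KIdeal.map_principal φ x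

/-- The square prescribes `v` on principal ideals, where `idl.map φ` has the same values. It
underlies both the `χ`-squares for bases and the `ξ`-squares for Boolean algebras. -/
theorem principalHom_square_iff {X Y : PosetSite.{u}} (φ : X ⟶ Y) (v : idl.obj X ⟶ idl.obj Y) :
    principalHom X ≫ frm.map v = φ ≫ principalHom Y ↔ v = idl.map φ := by
  rw [principal_comp]
  constructor
  · intro h
    exact idl_hom_ext fun x => congrFun (congrArg PosetSite.Hom.toFun h) x
  · intro h
    rw [h]

/-- The homomorphism from the frame of ideals extending a morphism of sites to a frame. -/
def idlLift {X : PosetSite.{u}} {C : Frm.{u}} (φ : X ⟶ frm.obj C) : idl.obj X ⟶ C :=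
  idl.map φ ≫ (isBasis_refl C).idlIso.hom

theorem idlLift_principal {X : PosetSite.{u}} {C : Frm.{u}} (φ : X ⟶ frm.obj C) (x : X) :
    idlLift φ (KIdeal.principal x) = φ.toFun x :=
  (congrArg (isBasis_refl C).idlIso.hom (idl_map_principal φ x)).trans
    ((isBasis_refl C).idlIso_hom_principal (φ.toFun x))

theorem principalHom_comp_idlLift {X : PosetSite.{u}} {C : Frm.{u}} (φ : X ⟶ frm.obj C) :
    principalHom X ≫ frm.map (idlLift φ) = φ :=
  PosetSite.hom_ext (idlLift_principal φ)

theorem idlLift_apply {X : PosetSite.{u}} {C : Frm.{u}} (φ : X ⟶ frm.obj C) (I : KIdeal X) :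
    idlLift φ I = sSup {a : C | ∃ x ∈ I, φ.toFun x = a} := by
  conv_lhs => rw [I.eq_sSup]
  exact (frm_map_sSup_image (idlLift φ) _ _).trans
    (congrArg sSup (Set.image_congr fun x _ => idlLift_principal φ x))

/-! ### Frames with bases -/

namespace BasisData

variable {H : ObjectProperty Frm.{u}} {K : ObjectProperty PosetSite.{u}} (B : BasisData H K)

/-- The isomorphism `Id(f(C)) ≅ C` sending an ideal to its join. -/
def joinIso (C : H.FullSubcategory) : B.g (B.f C) ≅ C :=
  H.isoMk (B.isBasis C).idlIso

/-- The morphism of sites `D → f(Id(D))` corestricting `d ↦ ↓d`. -/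
noncomputable def unitHom
    (h₁ : ∀ (D : K.FullSubcategory) (d : D.obj),
      ∃ b : (B.f (B.g D)).obj, B.ideal D b = KIdeal.principal d)
    (D : K.FullSubcategory) : D ⟶ B.f (B.g D) :=
  ObjectProperty.homMk ((B.isBasis (B.g D)).factor (principalHom D.obj) (h₁ D))

theorem unitHom_comp
    (h₁ : ∀ (D : K.FullSubcategory) (d : D.obj),
      ∃ b : (B.f (B.g D)).obj, B.ideal D b = KIdeal.principal d)
    (D : K.FullSubcategory) :
    (B.unitHom h₁ D).hom ≫ (B.isBasis (B.g D)).hom = principalHom D.obj :=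
  (B.isBasis (B.g D)).factor_comp _ _

/-- The inverse is the join map restricted to bases, which is available by `h₂`. Both composites are
identities after composing with the monic inclusions of the bases. -/
theorem isIso_unitHom
    (h₁ : ∀ (D : K.FullSubcategory) (d : D.obj),
      ∃ b : (B.f (B.g D)).obj, B.ideal D b = KIdeal.principal d)
    (h₂ : ∀ (C : H.FullSubcategory) (b : (B.f (B.g (B.f C))).obj),
      ∃ b' : (B.f C).obj, B.incl C b' = B.join C (B.ideal (B.f C) b))
    (C : H.FullSubcategory) : IsIso (B.unitHom h₁ (B.f C)) := by
  let r : (B.f (B.g (B.f C))).obj ⟶ (B.f C).obj :=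
    (B.isBasis C).factor ((B.isBasis (B.g (B.f C))).hom ≫ frm.map (B.isBasis C).idlIso.hom) (h₂ C)
  have hr : r ≫ (B.isBasis C).hom =
      (B.isBasis (B.g (B.f C))).hom ≫ frm.map (B.isBasis C).idlIso.hom :=
    (B.isBasis C).factor_comp _ _
  have := (B.isBasis C).mono_hom
  have := (B.isBasis (B.g (B.f C))).mono_hom
  refine ⟨ObjectProperty.homMk r, ?_, ?_⟩
  · refine ObjectProperty.hom_ext _ ((cancel_mono (B.isBasis C).hom).1 ?_)
    change ((B.unitHom h₁ (B.f C)).hom ≫ r) ≫ _ = 𝟙 _ ≫ _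
    rw [Category.assoc, hr, ← Category.assoc, unitHom_comp, Category.id_comp]
    exact (B.isBasis C).principalHom_comp_idlIso
  · refine ObjectProperty.hom_ext _ ((cancel_mono (B.isBasis (B.g (B.f C))).hom).1 ?_)
    change (r ≫ (B.unitHom h₁ (B.f C)).hom) ≫ _ = 𝟙 _ ≫ _
    rw [Category.assoc, unitHom_comp, ← (B.isBasis C).hom_comp_idlIso_inv, ← Category.assoc, hr,
      Category.assoc, ← frm.map_comp, Iso.hom_inv_id, frm.map_id, Category.id_comp,
      Category.comp_id]

/-! ### Squares of toposes read as equations between morphisms of sites, and the hypotheses of the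
method. -/

theorem square_ξ_iff {C C' : H.FullSubcategory} (u : C ⟶ C') (v : B.f C ⟶ B.f C') :
    (H.ι ⋙ frm ⋙ Sh.rightOp).map u ≫ B.data.ξ C' =
        B.data.ξ C ≫ (K.ι ⋙ Sh.rightOp).map v ↔
      (B.isBasis C).hom ≫ frm.map u.hom = v.hom ≫ (B.isBasis C').hom := by
  rw [← (B.isBasis C).comparison_square_iff (B.isBasis C') u.hom v.hom,
    ← Quiver.Hom.op_inj.eq_iff, eq_comm]
  rfl

theorem square_χ_iff {D D' : K.FullSubcategory} (v : D ⟶ D') (z : B.g D ⟶ B.g D') :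
    (K.ι ⋙ Sh.rightOp).map v ≫ B.data.χ D' =
        B.data.χ D ≫ (H.ι ⋙ frm ⋙ Sh.rightOp).map z ↔ z.hom = idl.map v.hom := by
  change Sh.rightOp.map v.hom ≫ Sh.rightOp.map (principalHom D'.obj) =
    Sh.rightOp.map (principalHom D.obj) ≫ Sh.rightOp.map (frm.map z.hom) ↔ _
  rw [← Functor.map_comp, ← Functor.map_comp, Sh.rightOp.map_injective.eq_iff, eq_comm]
  exact principalHom_square_iff v.hom z.hom

theorem isIso_χ (D : K.FullSubcategory) : IsIso (B.data.χ D) := by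
  have := (isBasis_principal D.obj).isIso_Sh_map
  change IsIso (Sh.map (principalHom D.obj).op).op
  exact inferInstanceAs (IsIso (Sh.map (isBasis_principal D.obj).hom.op).op)

/-- The Comparison Lemma equivalences satisfy the hypotheses of the method. -/
noncomputable def conditions
    (h₁ : ∀ (D : K.FullSubcategory) (d : D.obj),
      ∃ b : (B.f (B.g D)).obj, B.ideal D b = KIdeal.principal d)
    (h₂ : ∀ (C : H.FullSubcategory) (b : (B.f (B.g (B.f C))).obj),
      ∃ b' : (B.f C).obj, B.incl C b' = B.join C (B.ideal (B.f C) b)) :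
    B.data.Conditions where
  ε := B.joinIso
  η := B.unitHom h₁
  ξ_comp_χ C := by
    change (B.isBasis C).comparison.inv.op ≫ Sh.rightOp.map (principalHom (B.f C).obj) =
      Sh.rightOp.map (frm.map (B.isBasis C).idlIso.inv)
    rw [← (B.isBasis C).hom_comp_idlIso_inv, Functor.map_comp, ← Category.assoc]
    have : (B.isBasis C).comparison.inv.op ≫ Sh.rightOp.map (B.isBasis C).hom = 𝟙 _ :=
      Quiver.Hom.unop_inj (B.isBasis C).comparison.hom_inv_id
    rw [this, Category.id_comp]
  χ_comp_ξ D := by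
    change Sh.rightOp.map (principalHom D.obj) ≫ (B.isBasis (B.g D)).comparison.inv.op =
      Sh.rightOp.map (B.unitHom h₁ D).hom
    rw [← B.unitHom_comp h₁, Functor.map_comp, Category.assoc]
    have : Sh.rightOp.map (B.isBasis (B.g D)).hom ≫ (B.isBasis (B.g D)).comparison.inv.op = 𝟙 _ :=
      Quiver.Hom.unop_inj (B.isBasis (B.g D)).comparison.inv_hom_id
    rw [this, Category.comp_id]
  isIso_ξ C := by
    change IsIso (B.isBasis C).comparison.inv.op
    infer_instance
  isIso_η := B.isIso_unitHom h₁ h₂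

theorem conditionA : B.data.ConditionA := by
  intro C C' x y y' h h'
  have := (B.isBasis C').mono_hom
  refine ObjectProperty.hom_ext _ ((cancel_mono (B.isBasis C').hom).1 ?_)
  exact ((B.square_ξ_iff x y).1 h).symm.trans ((B.square_ξ_iff x y').1 h')

theorem conditionB : B.data.ConditionB := fun D D' y x x' h h' =>
  ObjectProperty.hom_ext _ (((B.square_χ_iff y x).1 h).trans ((B.square_χ_iff y x').1 h').symm)

/-- A pointwise condition suffices because the corestriction of `u` to the bases, built by `factor`,
is automatically a morphism of sites. -/
theorem exists_square_ξ_iff {C C' : H.FullSubcategory} (u : C ⟶ C') :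
    (∃ v : B.f C ⟶ B.f C', (H.ι ⋙ frm ⋙ Sh.rightOp).map u ≫ B.data.ξ C' =
        B.data.ξ C ≫ (K.ι ⋙ Sh.rightOp).map v) ↔
      ∀ b : (B.f C).obj, ∃ b' : (B.f C').obj, B.incl C' b' = u.hom (B.incl C b) := by
  constructor
  · rintro ⟨v, hv⟩ b
    exact ⟨v.hom.toFun b,
      (congrFun (congrArg PosetSite.Hom.toFun ((B.square_ξ_iff u v).1 hv)) b).symm⟩
  · intro h
    exact ⟨ObjectProperty.homMk
      ((B.isBasis C').factor ((B.isBasis C).hom ≫ frm.map u.hom) h),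
      (B.square_ξ_iff _ _).2 ((B.isBasis C').factor_comp _ _).symm⟩

theorem incl_v {P P' : B.data.RTilde} (a : P ⟶ P') (b : (B.f P.obj).obj) :
    B.incl P'.obj (a.v.hom.toFun b) = a.u.hom (B.incl P.obj b) :=
  (congrFun (congrArg PosetSite.Hom.toFun ((B.square_ξ_iff a.u a.v).1 a.comm)) b).symm

theorem z_hom {Q Q' : B.data.STilde} (a : Q ⟶ Q') : a.z.hom = idl.map a.v.hom :=
  (B.square_χ_iff a.v a.z).1 a.comm_χ

theorem forgetR_faithful : B.data.forgetR.Faithful where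
  map_injective {P P'} a b h :=
    MethodData.RTilde.hom_ext h (B.conditionA _ _ a.u a.v b.v a.comm
      ((congrArg (fun x => (H.ι ⋙ frm ⋙ Sh.rightOp).map x ≫ B.data.ξ P'.obj) h).trans b.comm))

/-- The component `v` determines `z` as `Id(v)`, and `z` determines `w` by `conditionA`. -/
theorem forgetS_faithful : B.data.forgetS.Faithful where
  map_injective {Q Q'} a b h := by
    have hv : a.v = b.v := h
    have hz : a.z = b.z := ObjectProperty.hom_ext _ (by rw [z_hom, z_hom, hv])
    refine MethodData.STilde.hom_ext hz hv (B.conditionA _ _ a.z a.w b.w a.comm_ξ ?_)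
    rw [hz]
    exact b.comm_ξ

theorem exists_forgetR_iff (P P' : B.data.RTilde) (h : P.obj ⟶ P'.obj) :
    (∃ a : P ⟶ P', B.data.forgetR.map a = h) ↔
      ∀ b : (B.f P.obj).obj, ∃ b' : (B.f P'.obj).obj,
        B.incl P'.obj b' = h.hom (B.incl P.obj b) := by
  rw [← B.exists_square_ξ_iff h]
  constructor
  · rintro ⟨a, rfl⟩
    exact ⟨a.v, a.comm⟩
  · rintro ⟨v, hv⟩
    exact ⟨MethodData.RHom.mk h v hv, rfl⟩

theorem exists_forgetS_iff (Q Q' : B.data.STilde) (v : Q.obj ⟶ Q'.obj) :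
    (∃ a : Q ⟶ Q', B.data.forgetS.map a = v) ↔
      ∀ b : (B.f (B.g Q.obj)).obj, ∃ b' : (B.f (B.g Q'.obj)).obj,
        B.ideal Q'.obj b' = KIdeal.map v.hom (B.ideal Q.obj b) := by
  -- The only possible first component over `v`; what remains is whether a `w` exists, which is the
  -- question answered for `R̃`.
  let z : B.g Q.obj ⟶ B.g Q'.obj := ObjectProperty.homMk (idl.map v.hom)
  refine Iff.trans ?_ (B.exists_square_ξ_iff z)
  constructor
  · rintro ⟨a, rfl⟩
    have : z = a.z := ObjectProperty.hom_ext _ (B.z_hom a).symm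
    rw [this]
    exact ⟨a.w, a.comm_ξ⟩
  · rintro ⟨w, hw⟩
    exact ⟨MethodData.SHom.mk z v w ((B.square_χ_iff v z).2 rfl) hw, rfl⟩

end BasisData

/-! ### Boolean algebras -/

section Bool

/-- An element of a Boolean algebra, as an element of the associated site. -/
abbrev siteElt {B : BoolAlg.{u}} (b : B) : (boolSite.obj B).carrier := b

/-- The elements of `t` witness that the members of `I` below the join form a coherent cover of it.
Thus ideals for the coherent topology are ideals in the lattice sense, with `⊥` coming from the
empty cover. -/
theorem KIdeal.sup_mem {B : BoolAlg.{u}} (I : KIdeal (boolSite.obj B)) (t : Finset B)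
    (ht : ∀ a ∈ t, siteElt a ∈ I) : siteElt (t.sup id) ∈ I := by
  let S : Sieve (siteElt (t.sup id)) :=
    { arrows := fun e _ => e ∈ I
      downward_closed := fun h g => I.lower (leOfHom g) h }
  refine I.closed _ S ⟨t, fun (e : B) he =>
    ⟨homOfLE (Finset.le_sup he : id e ≤ t.sup id), ht e he⟩, rfl⟩ ?_
  exact fun e k hk => hk

theorem KIdeal.sup_mem_pair {B : BoolAlg.{u}} (I : KIdeal (boolSite.obj B)) {a b : B}
    (ha : siteElt a ∈ I) (hb : siteElt b ∈ I) :
    siteElt (a ⊔ b) ∈ I := by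
  classical
  have := KIdeal.sup_mem I {a, b} (by
    intro c hc
    rcases Finset.mem_insert.1 hc with rfl | hc
    · exact ha
    · rw [Finset.mem_singleton.1 hc]; exact hb)
  simpa using this

theorem KIdeal.bot_mem {B : BoolAlg.{u}} (I : KIdeal (boolSite.obj B)) :
    siteElt (⊥ : B) ∈ I :=
  KIdeal.sup_mem I ∅ (by simp)

theorem KIdeal.principal_bot {B : BoolAlg.{u}} :
    KIdeal.principal (siteElt (⊥ : B)) = ⊥ :=
  le_antisymm (KIdeal.principal_le.2 (KIdeal.bot_mem _)) bot_le

/-- The elements below a join of an element of `I` and one of `I'`, as an ideal. -/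
def KIdeal.join {B : BoolAlg.{u}} (I I' : KIdeal (boolSite.obj B)) : KIdeal (boolSite.obj B) where
  carrier := {x : B | ∃ a b : B, siteElt a ∈ I ∧
    siteElt b ∈ I' ∧ x ≤ a ⊔ b}
  lower := fun d e h ⟨a, b, ha, hb, hd⟩ => ⟨a, b, ha, hb, le_trans (α := B) h hd⟩
  closed := fun (d : B) S ⟨t, ht, hd⟩ h => by
    have : ∀ e ∈ t, ∃ a b : B, siteElt a ∈ I ∧
        siteElt b ∈ I' ∧ e ≤ a ⊔ b := fun e he => by
      obtain ⟨k, hk⟩ := ht e he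
      exact h e k hk
    rw [← hd]
    refine Finset.sup_induction (p := fun x : B => ∃ a b : B,
      siteElt a ∈ I ∧
        siteElt b ∈ I' ∧ x ≤ a ⊔ b) ?_ ?_ this
    · exact ⟨⊥, ⊥, KIdeal.bot_mem I, KIdeal.bot_mem I', bot_le⟩
    · rintro x ⟨a, b, ha, hb, hx⟩ y ⟨a', b', ha', hb', hy⟩
      refine ⟨a ⊔ a', b ⊔ b', KIdeal.sup_mem_pair I ha ha', KIdeal.sup_mem_pair I' hb hb', ?_⟩
      rw [sup_sup_sup_comm]
      exact sup_le_sup hx hy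

theorem KIdeal.sup_le_join {B : BoolAlg.{u}} (I I' : KIdeal (boolSite.obj B)) :
    I ⊔ I' ≤ KIdeal.join I I' :=
  sup_le (fun a ha => ⟨a, (⊥ : B), ha, KIdeal.bot_mem I', le_sup_left (α := B)⟩)
    (fun b hb => ⟨(⊥ : B), b, KIdeal.bot_mem I, hb, le_sup_right (α := B)⟩)

/-- A complemented ideal of a Boolean algebra is principal. -/
theorem KIdeal.exists_eq_principal {B : BoolAlg.{u}} {I : KIdeal (boolSite.obj B)}
    (hI : IsComplemented I) : ∃ b : B, KIdeal.principal (siteElt b) = I := by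
  obtain ⟨I', h⟩ := hI
  -- Compactness of the top element: it lies below `a ⊔ b` for single elements of the two
  -- complementary ideals. The element `a` will generate `I`.
  have ht : siteElt (⊤ : B) ∈ KIdeal.join I I' :=
    KIdeal.sup_le_join I I' (by rw [h.sup_eq_top]; exact KIdeal.mem_top _)
  obtain ⟨a, b, ha, hb, hab⟩ := ht
  refine ⟨a, le_antisymm (KIdeal.principal_le.2 ha) fun (x : B) hx => ?_⟩
  -- Disjointness kills `x ⊓ b`, so `x = (x ⊓ a) ⊔ (x ⊓ b)` is below `a`.
  have hxb : siteElt (x ⊓ b) ∈ I ⊓ I' :=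
    ⟨I.lower (inf_le_left (α := B)) hx, I'.lower (inf_le_right (α := B)) hb⟩
  rw [h.inf_eq_bot, ← KIdeal.principal_bot] at hxb
  have hxb' : x ⊓ b ≤ ⊥ := hxb
  have : x ⊓ (a ⊔ b) ≤ a := by
    rw [inf_sup_left]
    exact sup_le inf_le_right (hxb'.trans bot_le)
  exact (le_inf le_rfl (le_top.trans hab)).trans this

theorem KIdeal.principal_inf {B : BoolAlg.{u}} (a b : B) :
    KIdeal.principal (siteElt (a ⊓ b)) =
      KIdeal.principal (siteElt a) ⊓ KIdeal.principal (siteElt b) :=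
  SetLike.ext fun (x : B) => le_inf_iff (α := B)

theorem KIdeal.principal_sup {B : BoolAlg.{u}} (a b : B) :
    KIdeal.principal (siteElt (a ⊔ b)) =
      KIdeal.principal (siteElt a) ⊔ KIdeal.principal (siteElt b) := by
  refine le_antisymm (KIdeal.principal_le.2 ?_) (sup_le ?_ ?_)
  · exact KIdeal.sup_mem_pair _ (KIdeal.principal_le.1 le_sup_left)
      (KIdeal.principal_le.1 le_sup_right)
  · exact KIdeal.principal_le.2 (le_sup_left (α := B))
  · exact KIdeal.principal_le.2 (le_sup_right (α := B))

theorem KIdeal.principal_top {B : BoolAlg.{u}} :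
    KIdeal.principal (siteElt (⊤ : B)) = ⊤ :=
  top_le_iff.1 fun (x : B) _ => le_top (α := B)

theorem KIdeal.isComplemented_principal {B : BoolAlg.{u}} (b : B) :
    IsComplemented (KIdeal.principal (siteElt b)) :=
  ⟨KIdeal.principal (siteElt (bᶜ : B)), IsCompl.of_eq
    (by rw [← KIdeal.principal_inf, inf_compl_eq_bot, KIdeal.principal_bot])
    (by rw [← KIdeal.principal_sup, sup_compl_eq_top, KIdeal.principal_top])⟩

/-- A Boolean algebra is isomorphic, by `b ↦ ↓b`, to the algebra of complemented ideals. -/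
noncomputable def principalIso (B : BoolAlg.{u}) :
    B ≅ complemented.obj (idl.obj (boolSite.obj B)) :=
  BoolAlg.Iso.mk (β := BoolAlg.of (Complementeds (idl.obj (boolSite.obj B))))
    (RelIso.ofSurjective
    (r := ((· ≤ ·) : B → B → Prop))
    (s := ((· ≤ ·) : Complementeds (KIdeal (boolSite.obj B)) → _ → Prop))
    { toFun := fun b : B => (⟨KIdeal.principal (siteElt b),
        KIdeal.isComplemented_principal b⟩ : Complementeds (KIdeal (boolSite.obj B)))
      inj' := fun a b h => (principalEmbedding (boolSite.obj B)).injective (congrArg Subtype.val h)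
      map_rel_iff' := fun {a b} => (principalEmbedding (boolSite.obj B)).le_iff_le (a := a) (b := b) }
    (fun I => by
      obtain ⟨b, hb⟩ := KIdeal.exists_eq_principal I.2
      exact ⟨b, Subtype.ext hb⟩))

theorem map_principalIso_hom_comp (B : BoolAlg.{u}) :
    boolSite.map (principalIso B).hom ≫ complementedHom (idl.obj (boolSite.obj B)) =
      principalHom (boolSite.obj B) := rfl

theorem map_principalIso_inv_comp (B : BoolAlg.{u}) :
    boolSite.map (principalIso B).inv ≫ principalHom (boolSite.obj B) =
      complementedHom (idl.obj (boolSite.obj B)) := by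
  rw [← map_principalIso_hom_comp, ← Category.assoc, ← boolSite.map_comp, Iso.inv_hom_id,
    boolSite.map_id, Category.id_comp]

/-- The homomorphism from the ideals of complemented elements of a frame, sending an ideal to its
join. -/
noncomputable def complementedJoin (F : Frm.{u}) :
    idl.obj (boolSite.obj (complemented.obj F)) ⟶ F := idlLift (complementedHom F)

theorem complementedJoin_principal (F : Frm.{u}) (a : complemented.obj F) :
    complementedJoin F (KIdeal.principal (siteElt a)) = (a : Complementeds F).1 :=
  idlLift_principal (complementedHom F) a

theorem principalHom_comp_complementedJoin (F : Frm.{u}) :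
    principalHom _ ≫ frm.map (complementedJoin F) = complementedHom F :=
  principalHom_comp_idlLift (complementedHom F)

/-- On principal ideals the composite sends `↓b` to `↓(↓b)` and back to `↓b`. This is also the left
triangle identity of `stoneAdjunction`. -/
theorem map_principalIso_comp_complementedJoin (B : BoolAlg.{u}) :
    idl.map (boolSite.map (principalIso B).hom) ≫
      complementedJoin (idl.obj (boolSite.obj B)) = 𝟙 _ :=
  idl_hom_ext fun b =>
    (congrArg (complementedJoin (idl.obj (boolSite.obj B)))
      (idl_map_principal (boolSite.map (principalIso B).hom) b)).trans
    (complementedJoin_principal _ ((principalIso B).hom (show B from b)))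

/-- The join map at `Id(B)` is a one-sided inverse of an isomorphism, namely the image of
`principalIso`. For a general frame it need not be invertible. -/
theorem isIso_complementedJoin (B : BoolAlg.{u}) :
    IsIso (complementedJoin (idl.obj (boolSite.obj B))) :=
  have : IsIso (idl.map (boolSite.map (principalIso B).hom) ≫
      complementedJoin (idl.obj (boolSite.obj B))) := by
    rw [map_principalIso_comp_complementedJoin]; infer_instance
  IsIso.of_isIso_comp_left (idl.map (boolSite.map (principalIso B).hom)) _

theorem complementedHom_comp {F F' : Frm.{u}} (h : F ⟶ F') :
    complementedHom F ≫ frm.map h = boolSite.map (complemented.map h) ≫ complementedHom F' := rfl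

theorem mono_complementedHom (F : Frm.{u}) : Mono (complementedHom F) :=
  ⟨fun f g h => PosetSite.hom_ext fun x =>
    Subtype.val_injective (congrFun (congrArg PosetSite.Hom.toFun h) x)⟩

/-- The equivalences `Sh(B) ≃ Sh(Id(B))` and the geometric morphisms `Sh(F) → Sh(F_c)` satisfy the
hypotheses of the method. -/
noncomputable def stoneConditions : stoneData.{u}.Conditions where
  ε B := (principalIso B.unop).op
  η F := (complementedJoin F.unop).op
  ξ_comp_χ B := by
    change (isBasis_principal (boolSite.obj B.unop)).comparison.inv ≫
      Sh.map (complementedHom (idl.obj (boolSite.obj B.unop))).op =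
        Sh.map (boolSite.map (principalIso B.unop).inv).op
    -- The inclusion of the complemented ideals factors through `↓`, and the part given by `↓` is
    -- the comparison isomorphism, so it cancels.
    rw [← map_principalIso_inv_comp, op_comp, Sh.map_comp, Iso.inv_comp_eq]
    rfl
  χ_comp_ξ F := by
    change Sh.map (complementedHom F.unop).op ≫
      (isBasis_principal (boolSite.obj (complemented.obj F.unop))).comparison.inv =
        Sh.map (frm.map (complementedJoin F.unop)).op
    rw [← principalHom_comp_complementedJoin, op_comp, Sh.map_comp, Iso.comp_inv_eq]
    rfl
  isIso_ξ B := inferInstanceAs (IsIso (isBasis_principal (boolSite.obj B.unop)).comparison.inv)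
  isIso_η B := by
    have := isIso_complementedJoin B.unop
    change IsIso (complementedJoin (idl.obj (boolSite.obj B.unop))).op
    infer_instance

/-! ### Squares for Boolean algebras: each has exactly one solution. -/

theorem stone_square_ξ_iff {B B' : BoolAlg.{u}ᵒᵖ} (u : B ⟶ B')
    (v : stoneData.{u}.f B ⟶ stoneData.{u}.f B') :
    (boolSite.{u}.op ⋙ Sh).map u ≫ stoneData.{u}.ξ B' =
        stoneData.{u}.ξ B ≫ (frm.{u}.op ⋙ Sh).map v ↔
      v = (idl.map (boolSite.map u.unop)).op := by
  refine ((isBasis_principal (boolSite.obj B'.unop)).comparison_square_iff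
    (isBasis_principal (boolSite.obj B.unop)) v.unop (boolSite.map u.unop)).trans
    ((principalHom_square_iff (boolSite.map u.unop) v.unop).trans
      ⟨fun h => Quiver.Hom.unop_inj h, fun h => congrArg Quiver.Hom.unop h⟩)

/-- Frame homomorphisms preserve complemented elements, so `complemented.map v` solves the square;
the inclusion of `F'_c` in `F'` is monic, so it is the only solution. -/
theorem complementedHom_square_iff {F F' : Frm.{u}} (v : F ⟶ F')
    (z : complemented.obj F ⟶ complemented.obj F') :
    Sh.map (frm.map v).op ≫ Sh.map (complementedHom F).op =
      Sh.map (complementedHom F').op ≫ Sh.map (boolSite.map z).op ↔ z = complemented.map v := by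
  rw [← Sh.map_comp, ← Sh.map_comp, ← op_comp, ← op_comp, Sh.map_injective.eq_iff,
    Quiver.Hom.op_inj.eq_iff, complementedHom_comp]
  have := mono_complementedHom F'
  rw [cancel_mono, boolSite.map_injective.eq_iff, eq_comm]

theorem stone_square_χ_iff {F F' : Frm.{u}ᵒᵖ} (v : F ⟶ F')
    (z : stoneData.{u}.g F ⟶ stoneData.{u}.g F') :
    (frm.{u}.op ⋙ Sh).map v ≫ stoneData.{u}.χ F' =
        stoneData.{u}.χ F ≫ (boolSite.{u}.op ⋙ Sh).map z ↔
      z = (complemented.map v.unop).op :=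
  (complementedHom_square_iff v.unop z.unop).trans
    ⟨fun h => Quiver.Hom.unop_inj h, fun h => congrArg Quiver.Hom.unop h⟩

theorem stone_v {P P' : stoneData.{u}.RTilde} (a : P ⟶ P') :
    a.v = (idl.map (boolSite.map a.u.unop)).op := (stone_square_ξ_iff a.u a.v).1 a.comm

theorem stone_z {Q Q' : stoneData.{u}.STilde} (a : Q ⟶ Q') :
    a.z = (complemented.map a.v.unop).op := (stone_square_χ_iff a.v a.z).1 a.comm_χ

theorem stone_w {Q Q' : stoneData.{u}.STilde} (a : Q ⟶ Q') :
    a.w = (idl.map (boolSite.map a.z.unop)).op := (stone_square_ξ_iff a.z a.w).1 a.comm_ξ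

theorem stone_forgetR_isEquivalence : stoneData.{u}.forgetR.IsEquivalence where
  faithful := ⟨fun {P P'} a b h => by
    have hu : a.u = b.u := h
    exact MethodData.RTilde.hom_ext hu (by rw [stone_v, stone_v, hu])⟩
  full := ⟨fun {P P'} u => ⟨MethodData.RHom.mk u _ ((stone_square_ξ_iff u _).2 rfl), rfl⟩⟩
  essSurj := ⟨fun B => ⟨⟨B⟩, ⟨Iso.refl _⟩⟩⟩

theorem stone_forgetS_isEquivalence : stoneData.{u}.forgetS.IsEquivalence where
  faithful := ⟨fun {Q Q'} a b h => by
    have hv : a.v = b.v := h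
    have hz : a.z = b.z := by rw [stone_z, stone_z, hv]
    exact MethodData.STilde.hom_ext hz hv (by rw [stone_w, stone_w, hz])⟩
  full := ⟨fun {Q Q'} v => ⟨MethodData.SHom.mk _ v _ ((stone_square_χ_iff v _).2 rfl)
    ((stone_square_ξ_iff _ _).2 rfl), rfl⟩⟩
  essSurj := ⟨fun F => ⟨⟨F⟩, ⟨Iso.refl _⟩⟩⟩

/-- Along the projections, `Z̃` becomes the functor of ideals. -/
noncomputable def stoneZTildeIso : stoneConditions.{u}.ZTilde ⋙ stoneData.{u}.forgetS ≅
    stoneData.{u}.forgetR ⋙ (boolSite ⋙ idl).op :=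
  -- The two functors agree on objects, and on arrows the `ξ`-square forces the component `v` to be
  -- the image of `u` under ideals.
  NatIso.ofComponents (fun P => Iso.refl _) fun {P P'} a =>
    (Category.comp_id _).trans ((stone_v a).trans (Category.id_comp _).symm)

/-- Along the projections, `W̃` becomes the functor of complemented elements. -/
noncomputable def stoneWTildeIso : stoneData.{u}.WTilde ⋙ stoneData.{u}.forgetR ≅
    stoneData.{u}.forgetS ⋙ complemented.op :=
  NatIso.ofComponents (fun P => Iso.refl _) fun {P P'} a =>
    (Category.comp_id _).trans ((stone_z a).trans (Category.id_comp _).symm)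

/-! ### The adjunction between ideals and complemented elements. -/

theorem principalIso_naturality {B B' : BoolAlg.{u}} (h : B ⟶ B') :
    h ≫ (principalIso B').hom =
      (principalIso B).hom ≫ complemented.map (idl.map (boolSite.map h)) :=
  BoolAlg.ext fun b => Subtype.ext (idl_map_principal (boolSite.map h) b).symm

/-- Both sides send the principal ideal of a complemented element `a` to `h a`, which suffices by
`idl_hom_ext`. -/
theorem complementedJoin_naturality {F F' : Frm.{u}} (h : F ⟶ F') :
    idl.map (boolSite.map (complemented.map h)) ≫ complementedJoin F' = complementedJoin F ≫ h :=
  idl_hom_ext fun a =>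
    (congrArg (complementedJoin F') (idl_map_principal (boolSite.map (complemented.map h)) a)).trans
      ((complementedJoin_principal F' _).trans
        (congrArg h (complementedJoin_principal F (show complemented.obj F from a))).symm)

theorem principalIso_comp_complementedJoin (F : Frm.{u}) :
    (principalIso (complemented.obj F)).hom ≫ complemented.map (complementedJoin F) = 𝟙 _ :=
  BoolAlg.ext fun a => Subtype.ext (complementedJoin_principal F a)

/-- The functor of ideals is left adjoint to the functor of complemented elements. -/
noncomputable def stoneAdjunction : boolSite.{u} ⋙ idl ⊣ complemented.{u} :=
  Adjunction.mkOfUnitCounit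
    { unit :=
        { app := fun B => (principalIso B).hom
          naturality := fun _ _ h => principalIso_naturality h }
      counit :=
        { app := complementedJoin
          naturality := fun _ _ h => complementedJoin_naturality h }
      left_triangle := by
        ext1; funext B
        exact (congrArg (_ ≫ ·) (Category.id_comp _)).trans
          (map_principalIso_comp_complementedJoin B)
      right_triangle := by
        ext1; funext F
        exact (congrArg (_ ≫ ·) (Category.id_comp _)).trans
          (principalIso_comp_complementedJoin F) }

instance : IsIso stoneAdjunction.{u}.unit :=
  (NatTrans.isIso_iff_isIso_app _).2 fun B => inferInstanceAs (IsIso (principalIso B).hom)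

end Bool

end FramePoset

open FramePoset

theorem mainTheorem4 :
    (∀ (H : ObjectProperty Frm.{u}) (K : ObjectProperty PosetSite.{u}) (B : BasisData H K),
      (∀ (D : K.FullSubcategory) (d : D.obj),
        ∃ b : (B.f (B.g D)).obj, B.ideal D b = KIdeal.principal d) →
      (∀ (C : H.FullSubcategory) (b : (B.f (B.g (B.f C))).obj),
        ∃ b' : (B.f C).obj,
          B.incl C b' = B.join C (B.ideal (B.f C) b)) →
      ∃ c : B.data.Conditions,
        (∀ (C : H.FullSubcategory) (I : KIdeal (B.f C).obj),
          (c.ε C).hom.hom I = B.join C I) ∧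
        (∀ (D : K.FullSubcategory) (d : D.obj),
          B.ideal D ((c.η D).hom.toFun d) = KIdeal.principal d) ∧
        (∀ D : K.FullSubcategory, IsIso (B.data.χ D)) ∧
        B.data.ConditionA ∧ B.data.ConditionB ∧
        (Nonempty (B.data.WTilde ⊣ c.ZTilde) ∧ c.ZTilde.Full ∧ c.ZTilde.Faithful) ∧
        (B.data.forgetR.Faithful ∧
          ∀ (P P' : B.data.RTilde) (h : P.obj ⟶ P'.obj),
            (∃ a : P ⟶ P', B.data.forgetR.map a = h) ↔
              ∀ b : (B.f P.obj).obj, ∃ b' : (B.f P'.obj).obj,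
                B.incl P'.obj b' = h.hom (B.incl P.obj b)) ∧
        (B.data.forgetS.Faithful ∧
          ∀ (Q Q' : B.data.STilde) (v : Q.obj ⟶ Q'.obj),
            (∃ a : Q ⟶ Q', B.data.forgetS.map a = v) ↔
              ∀ b : (B.f (B.g Q.obj)).obj, ∃ b' : (B.f (B.g Q'.obj)).obj,
                B.ideal Q'.obj b' = KIdeal.map v.hom (B.ideal Q.obj b)) ∧
        (∀ P : B.data.RTilde, (c.ZTilde.obj P).obj = B.f P.obj) ∧
        (∀ (P P' : B.data.RTilde) (a : P ⟶ P') (b : (B.f P.obj).obj),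
          B.incl P'.obj ((B.data.forgetS.map (c.ZTilde.map a)).hom.toFun b) =
            (B.data.forgetR.map a).hom (B.incl P.obj b)) ∧
        (∀ Q : B.data.STilde, (B.data.WTilde.obj Q).obj = B.g Q.obj) ∧
        (∀ (Q Q' : B.data.STilde) (a : Q ⟶ Q'),
          (B.data.forgetR.map (B.data.WTilde.map a)).hom =
            idl.map (B.data.forgetS.map a).hom)) ∧
    (∃ c : stoneData.{u}.Conditions,
      (Nonempty (stoneData.{u}.WTilde ⊣ c.ZTilde) ∧ c.ZTilde.Full ∧ c.ZTilde.Faithful) ∧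
      stoneData.{u}.forgetR.IsEquivalence ∧ stoneData.{u}.forgetS.IsEquivalence ∧
      Nonempty (c.ZTilde ⋙ stoneData.{u}.forgetS ≅
        stoneData.{u}.forgetR ⋙ (boolSite ⋙ idl).op) ∧
      Nonempty (stoneData.{u}.WTilde ⋙ stoneData.{u}.forgetR ≅
        stoneData.{u}.forgetS ⋙ complemented.op) ∧
      ∃ adj : boolSite.{u} ⋙ idl ⊣ complemented.{u},
        IsIso adj.unit ∧
        (∀ (B : BoolAlg.{u}) (b : B),
          (adj.unit.app B b : Complementeds (KIdeal (boolSite.obj B))).1 =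
            KIdeal.principal (X := boolSite.obj B) b) ∧
        (∀ (F : Frm.{u}) (I : KIdeal (boolSite.obj (complemented.obj F))),
          adj.counit.app F I = sSup {a : F | ∃ x ∈ I, (x : Complementeds F).1 = a})) :=
  ⟨fun _ _ B h₁ h₂ =>
    let c := B.conditions h₁ h₂
    ⟨c, fun _ _ => rfl, fun D d => (B.isBasis (B.g D)).factor_apply _ (h₁ D) d, B.isIso_χ,
      B.conditionA, B.conditionB, ⟨⟨c.adjunction⟩, c.ZTilde_full, c.ZTilde_faithful⟩,
      ⟨B.forgetR_faithful, B.exists_forgetR_iff⟩, ⟨B.forgetS_faithful, B.exists_forgetS_iff⟩,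
      fun _ => rfl, fun _ _ a b => B.incl_v a b, fun _ => rfl, fun _ _ a => B.z_hom a⟩,
    stoneConditions,
    ⟨⟨stoneConditions.adjunction⟩, stoneConditions.ZTilde_full, stoneConditions.ZTilde_faithful⟩,
    stone_forgetR_isEquivalence, stone_forgetS_isEquivalence, ⟨stoneZTildeIso⟩, ⟨stoneWTildeIso⟩,
    stoneAdjunction, inferInstance, fun _ _ => rfl, fun F I => idlLift_apply (complementedHom F) I⟩
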